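/- Let $\frac13<\beta<\frac12$, $T>0$, $1-\beta<\alpha<2\beta$ and $0<\varepsilon<\alpha+\beta-1$. **Definitions.** For $x,y:[0,T]\to\mathbb R$ we say that $(x,y,x\otimes y)$ is a real valued $\beta$-Hölder continuous multiplicative functional if $x,y$ are $\beta$-Hölder continuous and $x\otimes y$ is a continuous real function on $\{0\le s\le t\le T\}$ such that $(x\otimes y)_{s,u}+(x\otimes y)_{u,t}+(x_u-x_s)(y_t-y_u)=(x\otimes y)_{s,t}$ for $s\le u\le t$ and $|(x\otimes y)_{s,t}|\le C|t-s|^{2\beta}$ for some constant $C$. Put $$\|x\|_{s,t,\beta}=\sup_{s\le\theta<r\le t}\frac{|x_r-x_\theta|}{(r-\theta)^\beta},\qquad \|x\otimes y\|_{s,t,\beta}=\sup_{s\le\theta<r\le t}\frac{|(x\otimes y)_{\theta,r}|}{(r-\theta)^{2\beta}}$$ (a supremum over the empty set is $0$). With $(-1)^\alpha=e^{i\pi\alpha}$, for $0<\alpha<1$ the Weyl derivatives are $$D^\alpha_{a+}f(t)=\tfrac1{\Gamma(1-\alpha)}\Big(\tfrac{f(t)}{(t-a)^\alpha}+\alpha\int_a^t\tfrac{f(t)-f(s)}{(t-s)^{\alpha+1}}ds\Big),\quad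 D^\alpha_{b-}f(t)=\tfrac{(-1)^\alpha}{\Gamma(1-\alpha)}\Big(\tfrac{f(t)}{(b-t)^\alpha}+\alpha\int_t^b\tfrac{f(t)-f(s)}{(s-t)^{\alpha+1}}ds\Big),$$ and $f_{b-}(t)=f(t)-f(b)$. For $\theta<\xi<\eta$ let $$G(\theta,\xi,\eta)=\tfrac{(\xi-\theta)^{\alpha-1}(\eta-\xi)^{\alpha-1}}{\alpha\Gamma(\alpha)\Gamma(2\alpha-1)}\int_0^1q^{2\alpha-2}(1-q)^{-\alpha}\Big(1+(1-q)\tfrac{\xi-\theta}{\eta-\xi}\Big)^{-1}dq,$$ $$K_{\theta,b}(\xi,\eta)=-D^{\alpha-\varepsilon,\,\xi}_{\theta+}D^{\alpha-\varepsilon,\,\eta}_{b-}\big[G(\theta,\xi,\eta)-G(\theta,\xi,b)\big],\qquad \Gamma^{\gamma}\psi(\xi,\eta)=D^{1-\gamma,\,\xi}_{\eta-}D^{1-\gamma,\,\eta}_{\xi+}\psi(\xi,\eta),$$ where the second superscript is the variable on which the operator acts. Given real valued $\beta$-Hölder continuous multiplicative functionals $(x,y,x\otimes y)$ and $(y,z,y\otimes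 z)$, let, for $0\le a\le b\le c\le T$, $$\Lambda_{a,r,b,c}(x,z)=\tfrac{(-1)^\alpha}{\Gamma(1-\alpha)}\Big(\tfrac{(x_r-x_a)(z_c-z_r)}{(r-a)^\alpha}+\alpha\int_a^r\tfrac{(z_r-z_\theta)(x_\theta-x_r)}{(r-\theta)^{\alpha+1}}d\theta\Big),$$ $$\big(x\otimes(y\otimes z)_{\cdot,c}\big)_{a,b}=\int_a^b\Lambda_{a,r,b,c}(x,z)\,D^{1-\alpha}_{b-}y_{b-}(r)\,dr$$ $$\qquad+\tfrac1{\Gamma(2-2\alpha)}\int_{a<r<\xi<\eta<b}K_{r,b}(\xi,\eta)\,\frac{\Gamma^{\alpha-\varepsilon}(x\otimes y)_{\xi,\eta}(z_c-z_r)-(x_r-x_a)\,\Gamma^{\alpha-\varepsilon}(y\otimes z)_{\xi,\eta}}{(r-a)^{2\alpha-1}}\,dr\,d\xi\,d\eta .$$ Finally $(x\otimes y\otimes z)_{\theta,r}=\big(x\otimes(y\otimes z)_{\cdot,r}\big)_{\theta,r}$ and $\|x\otimes y\otimes z\|_{a,b,\beta}=\sup_{a\le\theta<r\le b}|(x\otimes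 y\otimes z)_{\theta,r}|/(r-\theta)^{3\beta}$. **Proposition.** There is a constant $k>0$ depending only on $\beta,\alpha,\varepsilon,T$ such that for all real valued $\beta$-Hölder continuous multiplicative functionals $(x,y,x\otimes y)$ and $(y,z,y\otimes z)$ on $[0,T]$ and all $0\le a\le b\le c\le T$ the two integrals (over $r$, and over $(r,\xi,\eta)$) that define $\big(x\otimes(y\otimes z)_{\cdot,c}\big)_{a,b}$ converge absolutely and $$\Big|\big(x\otimes(y\otimes z)_{\cdot,c}\big)_{a,b}\Big|\le k\big(\|y\|_{a,b,\beta}\|x\|_{a,b,\beta}\|z\|_{a,b,\beta}+\|z\|_{a,b,\beta}\|x\otimes y\|_{a,b,\beta}+\|x\|_{a,b,\beta}\|y\otimes z\|_{a,b,\beta}\big)(b-a)^{3\beta}$$ $$\qquad+k\|z\|_{a,c,\beta}\big(\|y\|_{a,b,\beta}\|x\|_{a,b,\beta}+\|x\otimes y\|_{a,b,\beta}\big)(b-a)^{2\beta}(c-a)^\beta .$$ In particular, for all $0\le a\le b\le T$ the norm $\|x\otimes y\otimes z\|_{a,b,\beta}$ is finite and $$\|x\otimes y\otimes z\|_{a,b,\beta}\le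 k\big(\|y\|_{a,b,\beta}\|x\|_{a,b,\beta}\|z\|_{a,b,\beta}+\|z\|_{a,b,\beta}\|x\otimes y\|_{a,b,\beta}+\|x\|_{a,b,\beta}\|y\otimes z\|_{a,b,\beta}\big).$$ -/

import Mathlib

open scoped NNReal

noncomputable section

namespace HolderRough

/-- `(x, y, x ⊗ y)` is a real valued `β`-Hölder continuous multiplicative functional on `[0, T]`;
only the values of `x`, `y` on `[0, T]` and of `xy = x ⊗ y` on `0 ≤ s ≤ t ≤ T` matter. -/
structure IsHolderMultiplicative (β T : ℝ) (x y : ℝ → ℝ) (xy : ℝ → ℝ → ℝ) : Prop where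
  holder_left : ∃ C : ℝ≥0, HolderOnWith C (Real.toNNReal β) x (Set.Icc 0 T)
  holder_right : ∃ C : ℝ≥0, HolderOnWith C (Real.toNNReal β) y (Set.Icc 0 T)
  continuousOn : ContinuousOn (fun p : ℝ × ℝ => xy p.1 p.2)
    {p : ℝ × ℝ | 0 ≤ p.1 ∧ p.1 ≤ p.2 ∧ p.2 ≤ T}
  multiplicative : ∀ s u t : ℝ, 0 ≤ s → s ≤ u → u ≤ t → t ≤ T →
    xy s u + xy u t + (x u - x s) * (y t - y u) = xy s t
  bound : ∃ C : ℝ, ∀ s t : ℝ, 0 ≤ s → s ≤ t → t ≤ T → |xy s t| ≤ C * (t - s) ^ (2 * β)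

/-- `‖x‖_{s,t,β}`, the supremum of `|x_r - x_θ| / (r - θ)^β` over `s ≤ θ < r ≤ t`. -/
def holderNorm (β s t : ℝ) (x : ℝ → ℝ) : ℝ :=
  sSup {v : ℝ | ∃ θ r : ℝ, s ≤ θ ∧ θ < r ∧ r ≤ t ∧ v = |x r - x θ| / (r - θ) ^ β}

/-- `‖x ⊗ y‖_{s,t,β}`, the supremum of `|(x ⊗ y)_{θ,r}| / (r - θ)^{2β}` over `s ≤ θ < r ≤ t`. -/
def holderNorm₂ (β s t : ℝ) (xy : ℝ → ℝ → ℝ) : ℝ :=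
  sSup {v : ℝ | ∃ θ r : ℝ, s ≤ θ ∧ θ < r ∧ r ≤ t ∧ v = |xy θ r| / (r - θ) ^ (2 * β)}

/-- `(-1)^α = e^{iπα}`. -/
def negOnePow (α : ℝ) : ℂ := Complex.exp (Complex.I * (Real.pi * α : ℝ))

/-- The left-sided Weyl derivative `D_{a+}^α f (t)`, for `a < t`. -/
def weylLeft (α a : ℝ) (f : ℝ → ℂ) (t : ℝ) : ℂ :=
  ((1 / Real.Gamma (1 - α) : ℝ) : ℂ) *
    (f t / ((t - a) ^ α : ℝ)
      + (α : ℂ) * ∫ s in a..t, (f t - f s) / ((t - s) ^ (α + 1) : ℝ))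

/-- The right-sided Weyl derivative `D_{b-}^α f (t)`, for `t < b`. -/
def weylRight (α b : ℝ) (f : ℝ → ℂ) (t : ℝ) : ℂ :=
  negOnePow α * ((1 / Real.Gamma (1 - α) : ℝ) : ℂ) *
    (f t / ((b - t) ^ α : ℝ)
      + (α : ℂ) * ∫ s in t..b, (f t - f s) / ((s - t) ^ (α + 1) : ℝ))

/-- The kernel `G(θ, ξ, η)`, for `θ < ξ < η`. -/
def kernelG (α θ ξ η : ℝ) : ℝ :=
  1 / (α * Real.Gamma α * Real.Gamma (2 * α - 1)) *
    (ξ - θ) ^ (α - 1) * (η - ξ) ^ (α - 1) *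
    ∫ q in (0 : ℝ)..1,
      q ^ (2 * α - 2) * (1 - q) ^ (-α) * (1 + (1 - q) * ((ξ - θ) / (η - ξ)))⁻¹

/-- The kernel `K_{θ,b}(ξ, η) = - D_{θ+}^{1,α-ε} D_{b-}^{2,α-ε} [G_{b-}(θ, ξ, η)]`, where
`G_{b-}(θ, ξ, η) = G(θ, ξ, η) - G(θ, ξ, b)`, the operator `D_{b-}^{2,α-ε}` acts on the variable `η`
and `D_{θ+}^{1,α-ε}` on the variable `ξ`. -/
def kernelK (α ε θ b ξ η : ℝ) : ℂ :=
  - weylLeft (α - ε) θ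
      (fun ξ' => weylRight (α - ε) b
        (fun η' => ((kernelG α θ ξ' η' - kernelG α θ ξ' b : ℝ) : ℂ)) η) ξ

/-- The operator `Γ^α ψ (ξ, η) = D_{η-}^{1-α,ξ} D_{ξ+}^{1-α,η} ψ (ξ, η)`, for `ξ < η`. -/
def gammaOp (α : ℝ) (ψ : ℝ → ℝ → ℝ) (ξ η : ℝ) : ℂ :=
  weylRight (1 - α) η
    (fun ξ' => weylLeft (1 - α) ξ' (fun η' => ((ψ ξ' η' : ℝ) : ℂ)) η) ξ

/-- `Λ_{a,r,b,c}(x, z)` (which does not depend on `b`). -/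
def bigLambda (α : ℝ) (x z : ℝ → ℝ) (a r c : ℝ) : ℂ :=
  negOnePow α * ((1 / Real.Gamma (1 - α) : ℝ) : ℂ) *
    (((x r - x a) * (z c - z r) / (r - a) ^ α
      + α * ∫ θ in a..r, (z r - z θ) * (x θ - x r) / (r - θ) ^ (α + 1) : ℝ) : ℂ)

/-- `Λ_{a,r,b,c}(x, z) D_{b-}^{1-α} y_{b-}(r)`, where `y_{b-}(s) = y_s - y_b`. -/
def firstIntegrand (α : ℝ) (x y z : ℝ → ℝ) (a b c r : ℝ) : ℂ :=
  bigLambda α x z a r c * weylRight (1 - α) b (fun s => ((y s - y b : ℝ) : ℂ)) r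

/-- The set of `(r, ξ, η)` with `a < r < ξ < η < b`. -/
def simplex (a b : ℝ) : Set (ℝ × ℝ × ℝ) :=
  {p | a < p.1 ∧ p.1 < p.2.1 ∧ p.2.1 < p.2.2 ∧ p.2.2 < b}

/-- The integrand of the triple integral over `a < r < ξ < η < b` at the point `(r, ξ, η)`. -/
def secondIntegrand (α ε : ℝ) (x z : ℝ → ℝ) (xy yz : ℝ → ℝ → ℝ) (a b c : ℝ)
    (p : ℝ × ℝ × ℝ) : ℂ :=
  kernelK α ε p.1 b p.2.1 p.2.2 *
    ((gammaOp (α - ε) xy p.2.1 p.2.2 * ((z c - z p.1 : ℝ) : ℂ)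
      - ((x p.1 - x a : ℝ) : ℂ) * gammaOp (α - ε) yz p.2.1 p.2.2)
      / ((p.1 - a) ^ (2 * α - 1) : ℝ))

/-- `(x ⊗ (y ⊗ z)_{·,c})_{a,b}`. It is written as a complex number because of the factors
`(-1)^α` in the fractional derivatives. -/
def tripleProduct (α ε : ℝ) (x y z : ℝ → ℝ) (xy yz : ℝ → ℝ → ℝ) (a b c : ℝ) : ℂ :=
  (∫ r in a..b, firstIntegrand α x y z a b c r)
    + ((1 / Real.Gamma (2 - 2 * α) : ℝ) : ℂ) *
        ∫ p in simplex a b, secondIntegrand α ε x z xy yz a b c p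

/-- The quotients `|(x ⊗ y ⊗ z)_{θ,r}| / (r - θ)^{3β}`, `a ≤ θ < r ≤ b`, where
`(x ⊗ y ⊗ z)_{θ,r} = (x ⊗ (y ⊗ z)_{·,r})_{θ,r}`. -/
def tripleQuotients (β α ε : ℝ) (x y z : ℝ → ℝ) (xy yz : ℝ → ℝ → ℝ) (a b : ℝ) : Set ℝ :=
  {v : ℝ | ∃ θ r : ℝ, a ≤ θ ∧ θ < r ∧ r ≤ b ∧
    v = ‖tripleProduct α ε x y z xy yz θ r r‖ / (r - θ) ^ (3 * β)}

/-- `‖x ⊗ y ⊗ z‖_{a,b,β}`. -/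
def holderNorm₃ (β α ε : ℝ) (x y z : ℝ → ℝ) (xy yz : ℝ → ℝ → ℝ) (a b : ℝ) : ℝ :=
  sSup (tripleQuotients β α ε x y z xy yz a b)

end HolderRough

end

/-! The estimate is a count of exponents: every factor of both integrands is bounded by a product of
powers of the gaps between consecutive points, each power is integrable, and the exponents add up to
the order claimed. The hypotheses force `1/2 < α < 1`.

Single integral. The boundary term of `Λ` and the product of increments of `x` and `z` under its
integral give a singularity `(r-a)^(β-α)`, integrable because `β - α > -1`; the derivative of `y` of
order `1-α < β` is bounded by `(b-r)^(α+β-1)`. Together they integrate to `(b-a)^(2β)`; the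
remaining factor of order `β` comes from `z`, as `‖z‖_{a,c} (c-a)^β` or `‖z‖_{a,b} (b-a)^β`.

Triple integral. Two bounds are needed. For `Γ^γ (x ⊗ y)`, multiplicativity expresses one-variable
increments of `x ⊗ y` by a shorter value plus a product of increments of `x` and `y`, and turns the
double increment into such a product alone. So derivatives of order `1-γ < β` can be taken in both
variables, with the bound `(η-ξ)^(2(β+γ-1))` (`exists_norm_gammaOp_le`). For `K`, the Pfaff
transformation rewrites `G` as a weighted integral over `s` of `u^(α-1) v^(2α-2) (v-su)^(1-α)`,
where `u = ξ-θ`, `v = η-θ` (`kernelG_eq`). Simple and double increments of this integrand are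
estimated for fixed `s`, by interpolating between its size and its derivatives, and then integrated
in `s`. A direct estimate of the double increment would leave the non-integrable weight
`(1-s)^(-1)`; giving up a small power `l` of `η-ξ` repairs this and yields `‖K_{θ,b}(ξ,η)‖ ≤ C
(b-θ)^l (ξ-θ)^(ε-1) (η-ξ)^(-1-l) (b-η)^ε` (`exists_norm_kernelK_le`).

With `l = α+β-1-ε` the operator `Γ^(α-ε)` contributes `(η-ξ)^(2l)`, which leaves the integrable
power `(η-ξ)^(l-1)`. Tonelli in the gaps `r-a`, `ξ-r`, `η-ξ` finishes the triple integral. The norm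
estimate is the case `b = c`. -/

namespace HolderRough

open MeasureTheory Set

/-! ### Beta type integrals -/

/-- Pointwise domination of a product of two singular powers by a sum. -/
theorem rpow_mul_rpow_le_add {x y p q : ℝ} (hx : 0 < x) (hy : 0 < y) (hp : p ≤ 1) (hq : q ≤ 1) :
    x ^ (p - 1) * y ^ (q - 1) ≤
      ((x + y) / 2) ^ (q - 1) * x ^ (p - 1) + ((x + y) / 2) ^ (p - 1) * y ^ (q - 1) := by
  have hm : 0 < (x + y) / 2 := by positivity
  rcases le_total x y with h | h
  · have h1 : y ^ (q - 1) ≤ ((x + y) / 2) ^ (q - 1) :=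
      Real.rpow_le_rpow_of_nonpos hm (by linarith) (by linarith)
    have h2 : 0 ≤ ((x + y) / 2) ^ (p - 1) * y ^ (q - 1) := by positivity
    have h3 : 0 ≤ x ^ (p - 1) := by positivity
    nlinarith
  · have h1 : x ^ (p - 1) ≤ ((x + y) / 2) ^ (p - 1) :=
      Real.rpow_le_rpow_of_nonpos hm (by linarith) (by linarith)
    have h2 : 0 ≤ ((x + y) / 2) ^ (q - 1) * x ^ (p - 1) := by positivity
    have h3 : 0 ≤ y ^ (q - 1) := by positivity
    nlinarith

theorem intervalIntegrable_sub_rpow {a b p : ℝ} (hp : 0 < p) :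
    IntervalIntegrable (fun s => (s - a) ^ (p - 1)) volume a b := by
  have := (intervalIntegral.intervalIntegrable_rpow' (a := 0) (b := b - a)
    (r := p - 1) (by linarith)).comp_sub_right a
  simpa using this

theorem integral_sub_rpow {a b p : ℝ} (hp : 0 < p) :
    ∫ s in a..b, (s - a) ^ (p - 1) = (b - a) ^ p / p := by
  rw [intervalIntegral.integral_comp_sub_right (fun s => s ^ (p - 1)) a, sub_self,
    integral_rpow (Or.inl (by linarith))]
  simp [Real.zero_rpow hp.ne']

theorem intervalIntegrable_rev_sub_rpow {a b p : ℝ} (hp : 0 < p) :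
    IntervalIntegrable (fun s => (b - s) ^ (p - 1)) volume a b := by
  have := (intervalIntegral.intervalIntegrable_rpow' (a := b - a) (b := 0)
    (r := p - 1) (by linarith)).comp_sub_left b
  simpa using this

theorem integral_rev_sub_rpow {a b p : ℝ} (hp : 0 < p) :
    ∫ s in a..b, (b - s) ^ (p - 1) = (b - a) ^ p / p := by
  rw [intervalIntegral.integral_comp_sub_left (fun s => s ^ (p - 1)) b, sub_self,
    integral_rpow (Or.inl (by linarith))]
  simp [Real.zero_rpow hp.ne']

/-- The constant in the bound of the incomplete Beta integrals. -/
noncomputable def betaConst (p q : ℝ) : ℝ := 2 ^ (1 - q) / p + 2 ^ (1 - p) / q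

theorem betaConst_nonneg {p q : ℝ} (hp : 0 < p) (hq : 0 < q) : 0 ≤ betaConst p q := by
  unfold betaConst; positivity

/-- An integrable majorant of `(s - a) ^ (p - 1) * (b - s) ^ (q - 1)`. -/
noncomputable def betaMajorant (a b p q s : ℝ) : ℝ :=
  ((b - a) / 2) ^ (q - 1) * (s - a) ^ (p - 1) + ((b - a) / 2) ^ (p - 1) * (b - s) ^ (q - 1)

theorem le_betaMajorant {a b p q s : ℝ} (hs : s ∈ Ioo a b) (hp : p ≤ 1) (hq : q ≤ 1) :
    (s - a) ^ (p - 1) * (b - s) ^ (q - 1) ≤ betaMajorant a b p q s := by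
  have := rpow_mul_rpow_le_add (sub_pos.2 hs.1) (sub_pos.2 hs.2) hp hq
  unfold betaMajorant
  convert this using 4 <;> ring

theorem intervalIntegrable_betaMajorant {a b p q : ℝ} (hp : 0 < p) (hq : 0 < q) :
    IntervalIntegrable (betaMajorant a b p q) volume a b :=
  ((intervalIntegrable_sub_rpow hp).const_mul _).add
    ((intervalIntegrable_rev_sub_rpow hq).const_mul _)

theorem integral_betaMajorant {a b p q : ℝ} (hab : a < b) (hp : 0 < p) (hq : 0 < q) :
    ∫ s in a..b, betaMajorant a b p q s = betaConst p q * (b - a) ^ (p + q - 1) := by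
  have hL : 0 < b - a := sub_pos.2 hab
  unfold betaMajorant
  rw [intervalIntegral.integral_add ((intervalIntegrable_sub_rpow hp).const_mul _)
    ((intervalIntegrable_rev_sub_rpow hq).const_mul _), intervalIntegral.integral_const_mul,
    intervalIntegral.integral_const_mul, integral_sub_rpow hp, integral_rev_sub_rpow hq, betaConst,
    Real.div_rpow hL.le zero_le_two, Real.div_rpow hL.le zero_le_two,
    show p + q - 1 = p + (q - 1) by ring, Real.rpow_add hL]
  have e1 : (b - a) ^ (p - 1) * (b - a) ^ q = (b - a) ^ p * (b - a) ^ (q - 1) := by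
    rw [← Real.rpow_add hL, ← Real.rpow_add hL]; congr 1; ring
  have e2 : ∀ r : ℝ, (2 : ℝ) ^ (1 - r) = ((2 : ℝ) ^ (r - 1))⁻¹ := fun r => by
    rw [← Real.rpow_neg zero_le_two]; congr 1; ring
  rw [e2, e2]
  have : (b - a) ^ (p - 1) / 2 ^ (p - 1) * ((b - a) ^ q / q)
      = ((b - a) ^ (p - 1) * (b - a) ^ q) * ((2 ^ (p - 1))⁻¹ / q) := by ring
  rw [this, e1]; ring

theorem ae_Ioo_of_forall {a b : ℝ} {P : ℝ → Prop} (h : ∀ s ∈ Ioo a b, P s) :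
    ∀ᵐ s ∂volume, s ∈ Ioc a b → P s := by
  filter_upwards [compl_mem_ae_iff.2 (measure_singleton b)] with s hs hs'
  exact h s ⟨hs'.1, lt_of_le_of_ne hs'.2 hs⟩

/-- The bound of a Beta type integral. -/
theorem norm_integral_le_betaConst {E : Type*} [NormedAddCommGroup E] [NormedSpace ℝ E]
    {a b p q M : ℝ} {f : ℝ → E} (hab : a < b) (hp : 0 < p) (hp1 : p ≤ 1)
    (hq : 0 < q) (hq1 : q ≤ 1) (hM : 0 ≤ M)
    (h : ∀ s ∈ Ioo a b, ‖f s‖ ≤ M * ((s - a) ^ (p - 1) * (b - s) ^ (q - 1))) :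
    ‖∫ s in a..b, f s‖ ≤ M * (betaConst p q * (b - a) ^ (p + q - 1)) := by
  rw [← integral_betaMajorant hab hp hq, ← intervalIntegral.integral_const_mul]
  refine intervalIntegral.norm_integral_le_of_norm_le hab.le (ae_Ioo_of_forall fun s hs => ?_)
    ((intervalIntegrable_betaMajorant hp hq).const_mul M)
  exact (h s hs).trans (mul_le_mul_of_nonneg_left (le_betaMajorant hs hp1 hq1) hM)

theorem intervalIntegrable_of_le_beta {E : Type*} [NormedAddCommGroup E]
    {a b p q M : ℝ} {f : ℝ → E} (hab : a ≤ b) (hp : 0 < p) (hp1 : p ≤ 1)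
    (hq : 0 < q) (hq1 : q ≤ 1) (hM : 0 ≤ M)
    (hf : AEStronglyMeasurable f (volume.restrict (Ioc a b)))
    (h : ∀ s ∈ Ioo a b, ‖f s‖ ≤ M * ((s - a) ^ (p - 1) * (b - s) ^ (q - 1))) :
    IntervalIntegrable f volume a b := by
  refine ((intervalIntegrable_betaMajorant hp hq).const_mul M).mono_fun ?_ ?_
  · rwa [uIoc_of_le hab]
  rw [uIoc_of_le hab, Filter.EventuallyLE, ae_restrict_iff' measurableSet_Ioc]
  refine ae_Ioo_of_forall fun s hs => ?_
  exact (h s hs).trans ((mul_le_mul_of_nonneg_left (le_betaMajorant hs hp1 hq1) hM).trans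
    (Real.le_norm_self _))

/-! ### Bounds for Weyl derivatives -/

theorem norm_negOnePow (α : ℝ) : ‖negOnePow α‖ = 1 := by
  rw [negOnePow, mul_comm, Complex.norm_exp_ofReal_mul_I]

theorem inv_Gamma_nonneg {δ : ℝ} (hδ1 : δ < 1) : 0 ≤ 1 / Real.Gamma (1 - δ) :=
  one_div_nonneg.2 (Real.Gamma_pos_of_pos (by linarith)).le

/-- The constant in the bounds of the Weyl derivatives. -/
noncomputable def weylConst (δ p q : ℝ) : ℝ := 1 / Real.Gamma (1 - δ) * (1 + δ * betaConst p q)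

theorem weylConst_nonneg {δ p q : ℝ} (hδ : 0 < δ) (hδ1 : δ < 1) (hp : 0 < p) (hq : 0 < q) :
    0 ≤ weylConst δ p q := by
  have := betaConst_nonneg hp hq
  have := inv_Gamma_nonneg hδ1
  unfold weylConst
  positivity

theorem norm_weyl_aux {δ G M P Q : ℝ} {A I : ℂ} (hδ : 0 < δ) (hG : 0 ≤ G)
    (hA : ‖A‖ ≤ M * P) (hI : ‖I‖ ≤ M * (Q * P)) :
    ‖((G : ℝ) : ℂ) * (A + (δ : ℂ) * I)‖ ≤ G * (1 + δ * Q) * M * P := by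
  rw [norm_mul, Complex.norm_real, Real.norm_of_nonneg hG]
  have h1 : ‖A + (δ : ℂ) * I‖ ≤ M * P + δ * (M * (Q * P)) := by
    refine (norm_add_le _ _).trans (add_le_add hA ?_)
    rw [norm_mul, Complex.norm_real, Real.norm_of_nonneg hδ.le]
    exact mul_le_mul_of_nonneg_left hI hδ.le
  exact (mul_le_mul_of_nonneg_left h1 hG).trans_eq (by ring)

/-- Dividing the increment by `(s-t)^(δ+1)` leaves a Beta integrand with exponents `p-1` and `q-1`,
and the boundary term scales in the same way. Taking `q < 1` allows increments that blow up at the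
far end point, which is what iterated derivatives produce; `q = 1` is the ordinary Hölder case. -/
theorem norm_weylRight_le {δ b t p q M : ℝ} {f : ℝ → ℂ} (hδ : 0 < δ) (hδ1 : δ < 1) (htb : t < b)
    (hp : 0 < p) (hp1 : p ≤ 1) (hq : 0 < q) (hq1 : q ≤ 1) (hM : 0 ≤ M)
    (h0 : ‖f t‖ ≤ M * (b - t) ^ (δ + p + q - 1))
    (h : ∀ s ∈ Ioo t b, ‖f t - f s‖ ≤ M * ((s - t) ^ (δ + p) * (b - s) ^ (q - 1))) :
    ‖weylRight δ b f t‖ ≤ weylConst δ p q * M * (b - t) ^ (p + q - 1) := by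
  have hL : 0 < b - t := sub_pos.2 htb
  rw [weylRight, mul_assoc, norm_mul, norm_negOnePow, one_mul, weylConst]
  refine norm_weyl_aux hδ (inv_Gamma_nonneg hδ1) ?_ ?_
  · rw [norm_div, Complex.norm_real, Real.norm_of_nonneg (by positivity), div_le_iff₀ (by positivity),
      mul_assoc, ← Real.rpow_add hL, show p + q - 1 + δ = δ + p + q - 1 by ring]
    exact h0
  · refine norm_integral_le_betaConst htb hp hp1 hq hq1 hM fun s hs => ?_
    have hs' : 0 < s - t := sub_pos.2 hs.1
    rw [norm_div, Complex.norm_real, Real.norm_of_nonneg (by positivity), div_le_iff₀ (by positivity)]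
    refine (h s hs).trans_eq ?_
    rw [show δ + p = (p - 1) + (δ + 1) by ring, Real.rpow_add hs']; ring

theorem norm_weylLeft_le {δ a t p q M : ℝ} {f : ℝ → ℂ} (hδ : 0 < δ) (hδ1 : δ < 1) (hat : a < t)
    (hp : 0 < p) (hp1 : p ≤ 1) (hq : 0 < q) (hq1 : q ≤ 1) (hM : 0 ≤ M)
    (h0 : ‖f t‖ ≤ M * (t - a) ^ (δ + p + q - 1))
    (h : ∀ s ∈ Ioo a t, ‖f t - f s‖ ≤ M * ((s - a) ^ (q - 1) * (t - s) ^ (δ + p))) :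
    ‖weylLeft δ a f t‖ ≤ weylConst δ q p * M * (t - a) ^ (p + q - 1) := by
  have hL : 0 < t - a := sub_pos.2 hat
  rw [weylLeft, weylConst, add_comm p q]
  refine norm_weyl_aux hδ (inv_Gamma_nonneg hδ1) ?_ ?_
  · rw [norm_div, Complex.norm_real, Real.norm_of_nonneg (by positivity), div_le_iff₀ (by positivity),
      mul_assoc, ← Real.rpow_add hL, show q + p - 1 + δ = δ + p + q - 1 by ring]
    exact h0
  · refine norm_integral_le_betaConst hat hq hq1 hp hp1 hM fun s hs => ?_
    have hs' : 0 < t - s := sub_pos.2 hs.2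
    rw [norm_div, Complex.norm_real, Real.norm_of_nonneg (by positivity), div_le_iff₀ (by positivity)]
    refine (h s hs).trans_eq ?_
    rw [show δ + p = (p - 1) + (δ + 1) by ring, Real.rpow_add hs']; ring

/-! ### The Euler integrand of `G` and its derivatives -/

/-- Interpolation between a bound of a function and a bound of its derivative. -/
theorem abs_sub_le_interpolate {f f' : ℝ → ℝ} {v t M w κ : ℝ} (hvt : v ≤ t) (hw : 0 < w)
    (hκ : 0 ≤ κ) (hκ1 : κ ≤ 1) (hf : ∀ τ ∈ Icc v t, HasDerivAt f (f' τ) τ)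
    (h0 : ∀ τ ∈ Icc v t, |f τ| ≤ M) (h1 : ∀ τ ∈ Icc v t, |f' τ| ≤ M / w) :
    |f v - f t| ≤ 2 * M * ((t - v) / w) ^ κ := by
  have hM : 0 ≤ M := (abs_nonneg _).trans (h0 v ⟨le_rfl, hvt⟩)
  have hr : 0 ≤ (t - v) / w := div_nonneg (sub_nonneg.2 hvt) hw.le
  -- Put `ρ = (t-v)/w`. For `ρ ≤ 1` the mean value inequality gives `M ρ ≤ M ρ^κ`; for `ρ ≥ 1` the
  -- two values give `2M ≤ 2M ρ^κ`.
  rcases le_total ((t - v) / w) 1 with h | h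
  · have h2 : ‖f t - f v‖ ≤ M / w * (t - v) :=
      norm_image_sub_le_of_norm_deriv_le_segment' (f' := f')
        (fun τ hτ => (hf τ hτ).hasDerivWithinAt)
        (fun τ hτ => h1 τ ⟨hτ.1, hτ.2.le⟩) t ⟨hvt, le_rfl⟩
    rw [Real.norm_eq_abs, abs_sub_comm] at h2
    have h3 : (t - v) / w ≤ ((t - v) / w) ^ κ := by
      rcases hr.eq_or_lt with h0' | h0'
      · rw [← h0']; positivity
      · simpa using Real.rpow_le_rpow_of_exponent_ge h0' h hκ1
    calc |f v - f t| ≤ M * ((t - v) / w) := h2.trans_eq (by ring)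
      _ ≤ M * ((t - v) / w) ^ κ := by gcongr
      _ ≤ _ := by nlinarith [mul_nonneg hM (Real.rpow_nonneg hr κ)]
  · have h2 := h0 v ⟨le_rfl, hvt⟩
    have h3 := h0 t ⟨hvt, le_rfl⟩
    have h4 := abs_sub (f v) (f t)
    have h5 := Real.one_le_rpow h hκ
    nlinarith

/-- The integrand of the Euler type representation of the kernel `G`, in the variables
`u = ξ - θ` and `v = η - θ`. -/
noncomputable def kernelF (α s u v : ℝ) : ℝ :=
  u ^ (α - 1) * (v ^ (2 * α - 2) * (v - s * u) ^ (1 - α))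

/-- The derivative of `kernelF` in `v`. -/
noncomputable def kernelFv (α s u v : ℝ) : ℝ :=
  u ^ (α - 1) * ((2 * α - 2) * v ^ (2 * α - 3) * (v - s * u) ^ (1 - α)
    + v ^ (2 * α - 2) * ((1 - α) * (v - s * u) ^ (-α)))

/-- The derivative of `kernelF` in `u`. -/
noncomputable def kernelFu (α s u v : ℝ) : ℝ :=
  (α - 1) * u ^ (α - 2) * (v ^ (2 * α - 2) * (v - s * u) ^ (1 - α))
    + u ^ (α - 1) * (v ^ (2 * α - 2) * (-(s * (1 - α)) * (v - s * u) ^ (-α)))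

/-- The mixed derivative of `kernelF`. -/
noncomputable def kernelFuv (α s u v : ℝ) : ℝ :=
  (α - 1) * u ^ (α - 2) * ((2 * α - 2) * v ^ (2 * α - 3) * (v - s * u) ^ (1 - α)
      + v ^ (2 * α - 2) * ((1 - α) * (v - s * u) ^ (-α)))
    + u ^ (α - 1) * ((2 * α - 2) * v ^ (2 * α - 3) * (-(s * (1 - α)) * (v - s * u) ^ (-α))
      + v ^ (2 * α - 2) * (-(s * (1 - α)) * (-α * (v - s * u) ^ (-α - 1))))

section Derivatives

variable {α s u v : ℝ}

theorem sub_mul_pos (hs : s ∈ Ioo (0 : ℝ) 1) (hu : 0 < u) (huv : u < v) : 0 < v - s * u := by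
  nlinarith [hs.1, hs.2]

theorem hasDerivAt_sub_rpow (r : ℝ) (h : 0 < v - s * u) :
    HasDerivAt (fun v => (v - s * u) ^ r) (r * (v - s * u) ^ (r - 1)) v := by
  have := ((hasDerivAt_id v).sub_const (s * u)).rpow_const (p := r) (Or.inl h.ne')
  simpa using this

theorem hasDerivAt_sub_mul_rpow (r : ℝ) (h : 0 < v - s * u) :
    HasDerivAt (fun u => (v - s * u) ^ r) (-(s * r) * (v - s * u) ^ (r - 1)) u := by
  have := (((hasDerivAt_id u).const_mul s).const_sub v).rpow_const (p := r) (Or.inl h.ne')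
  simpa using this

theorem hasDerivAt_kernelF_right (hs : s ∈ Ioo (0 : ℝ) 1) (hu : 0 < u) (huv : u < v) :
    HasDerivAt (kernelF α s u) (kernelFv α s u v) v := by
  have hm := sub_mul_pos hs hu huv
  have h1 := Real.hasDerivAt_rpow_const (x := v) (p := 2 * α - 2) (Or.inl (hu.trans huv).ne')
  have h2 := hasDerivAt_sub_rpow (1 - α) hm
  have := (h1.mul h2).const_mul (u ^ (α - 1))
  refine this.congr_deriv ?_
  unfold kernelFv
  rw [show 2 * α - 2 - 1 = 2 * α - 3 by ring, show 1 - α - 1 = -α by ring]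

theorem hasDerivAt_kernelF_left (hs : s ∈ Ioo (0 : ℝ) 1) (hu : 0 < u) (huv : u < v) :
    HasDerivAt (fun u => kernelF α s u v) (kernelFu α s u v) u := by
  have hm := sub_mul_pos hs hu huv
  have h1 := Real.hasDerivAt_rpow_const (x := u) (p := α - 1) (Or.inl hu.ne')
  have h2 := (hasDerivAt_sub_mul_rpow (1 - α) hm).const_mul (v ^ (2 * α - 2))
  refine (h1.mul h2).congr_deriv ?_
  unfold kernelFu
  rw [show α - 1 - 1 = α - 2 by ring, show 1 - α - 1 = -α by ring]

theorem hasDerivAt_kernelFu_right (hs : s ∈ Ioo (0 : ℝ) 1) (hu : 0 < u) (huv : u < v) :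
    HasDerivAt (kernelFu α s u) (kernelFuv α s u v) v := by
  have hm := sub_mul_pos hs hu huv
  have h1 := Real.hasDerivAt_rpow_const (x := v) (p := 2 * α - 2) (Or.inl (hu.trans huv).ne')
  have h2 := hasDerivAt_sub_rpow (1 - α) hm
  have h3 := (hasDerivAt_sub_rpow (-α) hm).const_mul (-(s * (1 - α)))
  refine (((h1.mul h2).const_mul ((α - 1) * u ^ (α - 2))).add
    ((h1.mul h3).const_mul (u ^ (α - 1)))).congr_deriv ?_
  unfold kernelFuv
  rw [show 2 * α - 2 - 1 = 2 * α - 3 by ring, show 1 - α - 1 = -α by ring]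

variable (hα : 1 / 2 < α) (hα1 : α < 1)
include hα hα1

theorem abs_kernelF_le (hs : s ∈ Ioo (0 : ℝ) 1) (hu : 0 < u) (huv : u < v) :
    |kernelF α s u v| ≤ u ^ (α - 1) * (v - u) ^ (α - 1) := by
  have hm := sub_mul_pos hs hu huv
  have hv := hu.trans huv
  have hw := sub_pos.2 huv
  have hmv : v - s * u ≤ v := by nlinarith [hs.1]
  unfold kernelF
  rw [abs_of_nonneg (by positivity)]
  gcongr
  calc v ^ (2 * α - 2) * (v - s * u) ^ (1 - α) ≤ v ^ (2 * α - 2) * v ^ (1 - α) := by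
        gcongr
    _ = v ^ (α - 1) := by rw [← Real.rpow_add hv]; congr 1; ring
    _ ≤ _ := Real.rpow_le_rpow_of_nonpos hw (by linarith) (by linarith)

/-- With `m = v - s u`, the inequality `m ≤ v` reduces the first term to the second. Both remaining
powers have negative exponents and can be evaluated at `v-u ≤ m ≤ v`. The coefficients `2α-2` and
`1-α` have absolute value at most `1`. -/
theorem abs_kernelFv_le (hs : s ∈ Ioo (0 : ℝ) 1) (hu : 0 < u) (huv : u < v) :
    |kernelFv α s u v| ≤ 2 * u ^ (α - 1) * (v - u) ^ (α - 2) := by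
  have hm := sub_mul_pos hs hu huv
  have hv := hu.trans huv
  have hw := sub_pos.2 huv
  have hmv : v - s * u ≤ v := by nlinarith [hs.1]
  have hwm : v - u ≤ v - s * u := by nlinarith [hs.2]
  set m := v - s * u with hmdef
  have e1 : v ^ (2 * α - 3) * m ^ (1 - α) ≤ v ^ (2 * α - 2) * m ^ (-α) := by
    calc v ^ (2 * α - 3) * m ^ (1 - α) = v ^ (2 * α - 3) * m * m ^ (-α) := by
          rw [show 1 - α = 1 + -α by ring, Real.rpow_add hm, Real.rpow_one]; ring
      _ ≤ v ^ (2 * α - 3) * v * m ^ (-α) := by gcongr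
      _ = _ := by
          rw [show 2 * α - 2 = 2 * α - 3 + 1 by ring, Real.rpow_add hv, Real.rpow_one]
  have e2 : v ^ (2 * α - 2) * m ^ (-α) ≤ (v - u) ^ (α - 2) := by
    calc v ^ (2 * α - 2) * m ^ (-α) ≤ (v - u) ^ (2 * α - 2) * (v - u) ^ (-α) :=
          mul_le_mul (Real.rpow_le_rpow_of_nonpos hw (by linarith) (by linarith))
            (Real.rpow_le_rpow_of_nonpos hw hwm (by linarith)) (by positivity) (by positivity)
      _ = _ := by rw [← Real.rpow_add hw]; congr 1; ring
  have p1 : 0 ≤ v ^ (2 * α - 3) * m ^ (1 - α) := by positivity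
  have p2 : 0 ≤ v ^ (2 * α - 2) * m ^ (-α) := by positivity
  unfold kernelFv
  rw [← hmdef, abs_mul, abs_of_nonneg (show 0 ≤ u ^ (α - 1) by positivity), mul_comm (2 : ℝ) (u ^ (α - 1)),
    mul_assoc (u ^ (α - 1)) 2]
  refine mul_le_mul_of_nonneg_left ?_ (by positivity)
  rw [abs_le]
  constructor <;> nlinarith

/-- Factoring out `u^(α-2) v^(2α-2) m^(-α)`, with `m = v - s u`, leaves a linear form in `m` and `u`
bounded by `2v`. The power of `m` is kept, because its dependence on `s` has to be divided between
the weight and `v-u` later. -/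
theorem abs_kernelFu_le_aux (hs : s ∈ Ioo (0 : ℝ) 1) (hu : 0 < u) (huv : u < v) :
    |kernelFu α s u v| ≤ 2 * u ^ (α - 2) * (v ^ (2 * α - 1) * (v - s * u) ^ (-α)) := by
  have hm := sub_mul_pos hs hu huv
  have hv := hu.trans huv
  have hmv : v - s * u ≤ v := by nlinarith [hs.1]
  have hs1 : s * (1 - α) ≤ 1 := by nlinarith [hs.1, hs.2]
  have hs0 : 0 ≤ s * (1 - α) := by nlinarith [hs.1, hs.2]
  unfold kernelFu
  set m := v - s * u with hmdef
  rw [show 1 - α = 1 + -α by ring, Real.rpow_add hm, Real.rpow_one,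
    show α - 1 = α - 2 + 1 by ring, Real.rpow_add hu, Real.rpow_one,
    show 2 * α - 1 = 2 * α - 2 + 1 by ring, Real.rpow_add hv, Real.rpow_one]
  rw [show 1 + -α = 1 - α by ring, show α - 2 + 1 = α - 1 by ring]
  set A := u ^ (α - 2) * v ^ (2 * α - 2) * m ^ (-α) with hA
  have hA0 : 0 ≤ A := by positivity
  rw [show (α - 1) * u ^ (α - 2) * (v ^ (2 * α - 2) * (m * m ^ (-α))) +
      u ^ (α - 2) * u * (v ^ (2 * α - 2) * (-(s * (1 - α)) * m ^ (-α))) =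
      A * ((α - 1) * m - s * (1 - α) * u) by rw [hA]; ring,
    show 2 * u ^ (α - 2) * (v ^ (2 * α - 2) * v * m ^ (-α)) = A * (2 * v) by rw [hA]; ring,
    abs_mul, abs_of_nonneg hA0]
  gcongr
  rw [abs_le]
  constructor <;> nlinarith

/-- After the common factor `u^(α-2) v^(2α-3) m^(-α-1)` is taken out, a quadratic form in `u`, `m`,
`v` with four terms remains, each at most `v^2`. -/
theorem abs_kernelFuv_le_aux (hs : s ∈ Ioo (0 : ℝ) 1) (hu : 0 < u) (huv : u < v) :
    |kernelFuv α s u v| ≤ 4 * u ^ (α - 2) * (v ^ (2 * α - 1) * (v - s * u) ^ (-α - 1)) := by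
  have hm := sub_mul_pos hs hu huv
  have hv := hu.trans huv
  have hmv : v - s * u ≤ v := by nlinarith [hs.1]
  have hs1 : s * (1 - α) ≤ 1 := by nlinarith [hs.1, hs.2]
  have hs0 : 0 ≤ s * (1 - α) := by nlinarith [hs.1, hs.2]
  unfold kernelFuv
  set m := v - s * u with hmdef
  have e1 : m ^ (1 - α) = m ^ (-α - 1) * m ^ 2 := by
    rw [← Real.rpow_natCast m 2, ← Real.rpow_add hm]; congr 1; push_cast; ring
  have e2 : m ^ (-α) = m ^ (-α - 1) * m := by
    nth_rewrite 3 [← Real.rpow_one m]; rw [← Real.rpow_add hm]; congr 1; ring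
  have e3 : u ^ (α - 1) = u ^ (α - 2) * u := by
    nth_rewrite 3 [← Real.rpow_one u]; rw [← Real.rpow_add hu]; congr 1; ring
  have e4 : v ^ (2 * α - 2) = v ^ (2 * α - 3) * v := by
    nth_rewrite 3 [← Real.rpow_one v]; rw [← Real.rpow_add hv]; congr 1; ring
  have e5 : v ^ (2 * α - 1) = v ^ (2 * α - 3) * v ^ 2 := by
    rw [← Real.rpow_natCast v 2, ← Real.rpow_add hv]; congr 1; push_cast; ring
  rw [e1, e2, e3, e4, e5]
  set A := u ^ (α - 2) * v ^ (2 * α - 3) * m ^ (-α - 1) with hA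
  have hA0 : 0 ≤ A := by positivity
  set σ := s * (1 - α) with hσ
  have bd : ∀ {k X : ℝ}, |k| ≤ 1 → 0 ≤ X → X ≤ v ^ 2 → |k * X| ≤ v ^ 2 := by
    intro k X hk hX hXv
    rw [abs_mul, abs_of_nonneg hX]
    exact (mul_le_of_le_one_left hX hk).trans hXv
  have h1 : |(α - 1) * (2 * α - 2) * m ^ 2| ≤ v ^ 2 :=
    bd (by rw [abs_le]; constructor <;> nlinarith) (by positivity) (by gcongr)
  have h2 : |(α - 1) * (1 - α) * (m * v)| ≤ v ^ 2 :=
    bd (by rw [abs_le]; constructor <;> nlinarith) (by positivity) (by nlinarith)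
  have h3 : |(2 - 2 * α) * σ * (u * m)| ≤ v ^ 2 :=
    bd (by rw [abs_le]; constructor <;> nlinarith) (by positivity) (by nlinarith)
  have h4 : |α * σ * (u * v)| ≤ v ^ 2 :=
    bd (by rw [abs_le]; constructor <;> nlinarith) (by positivity) (by nlinarith)
  have key : |(α - 1) * (2 * α - 2) * m ^ 2 + (α - 1) * (1 - α) * (m * v)
      + (2 - 2 * α) * σ * (u * m) + α * σ * (u * v)| ≤ 4 * v ^ 2 := by
    refine (abs_add_le _ _).trans ?_
    refine (add_le_add (abs_add_three _ _ _) h4).trans ?_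
    linarith only [h1, h2, h3]
  calc _ = |A * ((α - 1) * (2 * α - 2) * m ^ 2 + (α - 1) * (1 - α) * (m * v)
      + (2 - 2 * α) * σ * (u * m) + α * σ * (u * v))| := by rw [hA]; congr 1; ring
    _ ≤ A * (4 * v ^ 2) := by rw [abs_mul, abs_of_nonneg hA0]; gcongr
    _ = _ := by rw [hA]; ring

end Derivatives

/-! ### The Pfaff transformation of `G` -/

section Pfaff

variable {α θ ξ η : ℝ}

/-- The map is an involution of `(0,1)`, so the preimage of `q` is given by the same formula. -/
theorem pfaff_image {u v : ℝ} (hu : 0 < u) (huv : u < v) :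
    (fun s : ℝ => (1 - s) * v / (v - s * u)) '' Ioo 0 1 = Ioo 0 1 := by
  have hv := hu.trans huv
  ext q
  constructor
  · rintro ⟨s, hs, rfl⟩
    have hm := sub_mul_pos hs hu huv
    refine ⟨div_pos (mul_pos (by linarith [hs.2]) hv) hm, (div_lt_one hm).2 ?_⟩
    nlinarith [hs.1]
  · intro hq
    have hd : 0 < v - q * u := sub_mul_pos hq hu huv
    have hs : (1 - q) * v / (v - q * u) ∈ Ioo (0 : ℝ) 1 := by
      refine ⟨div_pos (mul_pos (by linarith [hq.2]) hv) hd, (div_lt_one hd).2 ?_⟩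
      nlinarith [hq.1]
    have hm := sub_mul_pos hs hu huv
    refine ⟨_, hs, ?_⟩
    simp only
    rw [div_eq_iff hm.ne']
    field_simp
    ring

theorem pfaff_injOn {u v : ℝ} (hu : 0 < u) (huv : u < v) :
    InjOn (fun s : ℝ => (1 - s) * v / (v - s * u)) (Ioo 0 1) := by
  intro s hs t ht h
  have h1 := sub_mul_pos hs hu huv
  have h2 := sub_mul_pos ht hu huv
  simp only [div_eq_div_iff h1.ne' h2.ne'] at h
  have h3 : (v * (v - u)) * (s - t) = 0 := by linear_combination -h
  have h4 : v * (v - u) ≠ 0 := (mul_pos (hu.trans huv) (sub_pos.2 huv)).ne'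
  have := (mul_eq_zero.1 h3).resolve_left h4
  linarith

theorem hasDerivAt_pfaff {s u v : ℝ} (h : 0 < v - s * u) :
    HasDerivAt (fun s : ℝ => (1 - s) * v / (v - s * u)) (-(v * (v - u) / (v - s * u) ^ 2)) s := by
  have h1 : HasDerivAt (fun s : ℝ => (1 - s) * v) (-v) s := by
    simpa using ((hasDerivAt_id s).const_sub 1).mul_const v
  have h2 : HasDerivAt (fun s : ℝ => v - s * u) (-u) s := by
    simpa using ((hasDerivAt_id s).mul_const u).const_sub v
  refine (h1.div h2 h.ne').congr_deriv ?_
  field_simp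
  ring

/-- The weight of the Euler type integral. -/
noncomputable def eulerWeight (α s : ℝ) : ℝ := s ^ (-α) * (1 - s) ^ (2 * α - 2)

/-- The Pfaff transformation of the hypergeometric integral defining the kernel `G`. -/
theorem kernelG_eq (h1 : θ < ξ) (h2 : ξ < η) :
    kernelG α θ ξ η = 1 / (α * Real.Gamma α * Real.Gamma (2 * α - 1)) *
      ∫ s in (0 : ℝ)..1, eulerWeight α s * kernelF α s (ξ - θ) (η - θ) := by
  set u := ξ - θ with hu'
  set v := η - θ with hv'
  have hu : 0 < u := sub_pos.2 h1
  have huv : u < v := by linarith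
  have hv := hu.trans huv
  have hw' : η - ξ = v - u := by rw [hu', hv']; ring
  have hw : 0 < v - u := sub_pos.2 huv
  unfold kernelG
  rw [← hu', hw', mul_assoc, mul_assoc]
  congr 1
  rw [intervalIntegral.integral_of_le zero_le_one, intervalIntegral.integral_of_le zero_le_one,
    integral_Ioc_eq_integral_Ioo, integral_Ioc_eq_integral_Ioo]
  nth_rewrite 1 [← pfaff_image hu huv]
  rw [integral_image_eq_integral_abs_deriv_smul measurableSet_Ioo
    (fun s hs => (hasDerivAt_pfaff (sub_mul_pos hs hu huv)).hasDerivWithinAt) (pfaff_injOn hu huv),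
    ← mul_assoc, ← integral_const_mul]
  refine setIntegral_congr_fun measurableSet_Ioo fun s hs => ?_
  have hm := sub_mul_pos hs hu huv
  have hs0 := hs.1
  have hs1 : 0 < 1 - s := by linarith [hs.2]
  unfold eulerWeight kernelF
  simp only [smul_eq_mul]
  set m := v - s * u with hmdef
  have e0 : |-(v * (v - u) / m ^ 2)| = v * (v - u) / m ^ 2 := by
    rw [abs_neg, abs_of_nonneg (by positivity)]
  have e1 : 1 - (1 - s) * v / m = s * (v - u) / m := by
    rw [eq_div_iff hm.ne', sub_mul, div_mul_cancel₀ _ hm.ne', hmdef]; ring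
  have e2 : 1 + s * (v - u) / m * (u / (v - u)) = v / m := by
    field_simp; rw [hmdef]; ring
  rw [e0, e1, e2, Real.div_rpow (by positivity) hm.le, Real.div_rpow (by positivity) hm.le,
    Real.mul_rpow hs1.le hv.le, Real.mul_rpow hs0.le hw.le, inv_div]
  -- The prefactor, the Jacobian and `(1-q)^(-α)` contribute powers of `η-ξ = v-u` that cancel
  -- exactly, so the new integrand is singular in `v-u` only through `m = v - s u`.
  have f1 : (v - u) ^ (α - 1) * (v - u) * (v - u) ^ (-α) = 1 := by
    nth_rewrite 2 [← Real.rpow_one (v - u)]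
    rw [← Real.rpow_add hw, ← Real.rpow_add hw, show α - 1 + 1 + -α = 0 by ring, Real.rpow_zero]
  have f2 : m / (m ^ 2 * (m ^ (2 * α - 2) * m ^ (-α))) = m ^ (1 - α) := by
    rw [div_eq_iff (by positivity), ← Real.rpow_natCast m 2, ← Real.rpow_add hm,
      ← Real.rpow_add hm, ← Real.rpow_add hm]
    nth_rewrite 1 [← Real.rpow_one m]
    congr 1; push_cast; ring
  calc _ = s ^ (-α) * (1 - s) ^ (2 * α - 2) * (u ^ (α - 1) * (v ^ (2 * α - 2) *
        (m / (m ^ 2 * (m ^ (2 * α - 2) * m ^ (-α)))))) *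
        ((v - u) ^ (α - 1) * (v - u) * (v - u) ^ (-α)) := by
          field_simp
    _ = _ := by rw [f1, f2, mul_one]

end Pfaff

/-! ### Simple and double increments of the Euler integrand -/

section Differences

variable {α l L s u v t p κ : ℝ} (hα : 1 / 2 < α) (hα1 : α < 1)
include hα hα1

/-- The power of `m = v - s u` is split. The part `m^(l-(2α-1))` is estimated by `m ≥ (1-s) v`,
which absorbs the growing factor `v^(2α-1)` up to `v^l ≤ L^l` at the price of a power of `1-s`; the
rest is estimated by `m ≥ v-u`. The parameter `l` decides how much is charged to the integral over
`s`. -/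
theorem rpow_denominator_le {r : ℝ} (hl : 0 ≤ l) (hl1 : l ≤ 2 * α - 1) (hr : r ≤ -α)
    (hs : s ∈ Ioo (0 : ℝ) 1) (hu : 0 < u) (huv : u < v) (hvL : v ≤ L) :
    v ^ (2 * α - 1) * (v - s * u) ^ r ≤
      (1 - s) ^ (l - (2 * α - 1)) * L ^ l * (v - u) ^ (r + (2 * α - 1 - l)) := by
  have hm := sub_mul_pos hs hu huv
  have hv := hu.trans huv
  have hw := sub_pos.2 huv
  have hs1 : 0 < 1 - s := by linarith [hs.2]
  have hwm : v - u ≤ v - s * u := by nlinarith [hs.2]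
  have hsm : (1 - s) * v ≤ v - s * u := by nlinarith [hs.1]
  set m := v - s * u with hmdef
  have e1 : m ^ r = m ^ (l - (2 * α - 1)) * m ^ (r + (2 * α - 1 - l)) := by
    rw [← Real.rpow_add hm]; congr 1; ring
  have e2 : m ^ (l - (2 * α - 1)) ≤ (1 - s) ^ (l - (2 * α - 1)) * v ^ (l - (2 * α - 1)) := by
    rw [← Real.mul_rpow hs1.le hv.le]
    exact Real.rpow_le_rpow_of_nonpos (by positivity) hsm (by linarith)
  have e3 : m ^ (r + (2 * α - 1 - l)) ≤ (v - u) ^ (r + (2 * α - 1 - l)) :=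
    Real.rpow_le_rpow_of_nonpos hw hwm (by linarith)
  have e4 : v ^ (2 * α - 1) * v ^ (l - (2 * α - 1)) = v ^ l := by
    rw [← Real.rpow_add hv]; congr 1; ring
  have e5 : v ^ l ≤ L ^ l := Real.rpow_le_rpow hv.le hvL hl
  calc v ^ (2 * α - 1) * m ^ r
      ≤ v ^ (2 * α - 1) * (((1 - s) ^ (l - (2 * α - 1)) * v ^ (l - (2 * α - 1))) *
        (v - u) ^ (r + (2 * α - 1 - l))) := by rw [e1]; gcongr
    _ = (1 - s) ^ (l - (2 * α - 1)) * (v ^ (2 * α - 1) * v ^ (l - (2 * α - 1))) *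
        (v - u) ^ (r + (2 * α - 1 - l)) := by ring
    _ ≤ _ := by rw [e4]; gcongr

/-- On `[v,t]` the function is bounded by a multiple of `u^(α-1) (v-u)^(α-1)` and its derivative
loses exactly one factor `v-u`, so interpolation applies with `w = v-u`. The exponent `α` exceeds
the order `α-ε` of the derivative to be taken. -/
theorem abs_kernelF_sub_le (hs : s ∈ Ioo (0 : ℝ) 1) (hu : 0 < u) (huv : u < v) (hvt : v ≤ t) :
    |kernelF α s u v - kernelF α s u t| ≤
      4 * u ^ (α - 1) * (v - u) ^ (α - 1) * ((t - v) / (v - u)) ^ α := by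
  have hw := sub_pos.2 huv
  have := abs_sub_le_interpolate (f := kernelF α s u) (f' := kernelFv α s u) (v := v) (t := t)
    (M := 2 * u ^ (α - 1) * (v - u) ^ (α - 1)) (w := v - u) (κ := α) hvt hw (by linarith) hα1.le
    (fun τ hτ => hasDerivAt_kernelF_right hs hu (huv.trans_le hτ.1)) (fun τ hτ => ?_)
    (fun τ hτ => ?_)
  · exact this.trans_eq (by ring)
  · refine (abs_kernelF_le hα hα1 hs hu (huv.trans_le hτ.1)).trans ?_
    have h1 : (τ - u) ^ (α - 1) ≤ (v - u) ^ (α - 1) :=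
      Real.rpow_le_rpow_of_nonpos hw (by linarith [hτ.1]) (by linarith)
    have h2 : 0 ≤ u ^ (α - 1) * (v - u) ^ (α - 1) := by positivity
    calc u ^ (α - 1) * (τ - u) ^ (α - 1) ≤ u ^ (α - 1) * (v - u) ^ (α - 1) := by gcongr
      _ ≤ _ := by linarith
  · refine (abs_kernelFv_le hα hα1 hs hu (huv.trans_le hτ.1)).trans ?_
    have h1 : (τ - u) ^ (α - 2) ≤ (v - u) ^ (α - 2) :=
      Real.rpow_le_rpow_of_nonpos hw (by linarith [hτ.1]) (by linarith)
    rw [mul_div_assoc, ← Real.rpow_sub_one hw.ne', show α - 1 - 1 = α - 2 by ring]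
    gcongr

theorem abs_kernelFu_sub_le (hl : 0 ≤ l) (hl1 : l ≤ 2 * α - 1) (hs : s ∈ Ioo (0 : ℝ) 1)
    (hu : 0 < u) (huv : u < v) (hvt : v ≤ t) (htL : t ≤ L) :
    |kernelFu α s u v - kernelFu α s u t| ≤
      8 * ((1 - s) ^ (l - (2 * α - 1)) * L ^ l) * u ^ (α - 2) * (v - u) ^ (α - 1 - l) *
        ((t - v) / (v - u)) ^ α := by
  have hw := sub_pos.2 huv
  have hs1 : 0 < 1 - s := by linarith [hs.2]
  have hL : 0 < L := by linarith
  set Q := (1 - s) ^ (l - (2 * α - 1)) * L ^ l with hQ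
  have hQ0 : 0 < Q := by positivity
  have := abs_sub_le_interpolate (f := kernelFu α s u) (f' := kernelFuv α s u) (v := v) (t := t)
    (M := 4 * Q * u ^ (α - 2) * (v - u) ^ (α - 1 - l)) (w := v - u) (κ := α) hvt hw (by linarith)
    hα1.le (fun τ hτ => hasDerivAt_kernelFu_right hs hu (huv.trans_le hτ.1)) (fun τ hτ => ?_)
    (fun τ hτ => ?_)
  · exact this.trans_eq (by ring)
  · refine (abs_kernelFu_le_aux hα hα1 hs hu (huv.trans_le hτ.1)).trans ?_
    have h0 := rpow_denominator_le hα hα1 hl hl1 le_rfl hs hu (huv.trans_le hτ.1)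
      (hτ.2.trans htL)
    have h1 : (τ - u) ^ (α - 1 - l) ≤ (v - u) ^ (α - 1 - l) :=
      Real.rpow_le_rpow_of_nonpos hw (by linarith [hτ.1]) (by linarith)
    rw [show -α + (2 * α - 1 - l) = α - 1 - l by ring, ← hQ] at h0
    calc _ ≤ 2 * u ^ (α - 2) * (Q * (v - u) ^ (α - 1 - l)) := by
          exact mul_le_mul_of_nonneg_left (h0.trans (by gcongr)) (by positivity)
      _ ≤ 4 * u ^ (α - 2) * (Q * (v - u) ^ (α - 1 - l)) := by gcongr; norm_num
      _ = _ := by ring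
  · refine (abs_kernelFuv_le_aux hα hα1 hs hu (huv.trans_le hτ.1)).trans ?_
    have h0 := rpow_denominator_le hα hα1 (r := -α - 1) hl hl1 (by linarith) hs hu
      (huv.trans_le hτ.1) (hτ.2.trans htL)
    have h1 : (τ - u) ^ (α - 1 - l - 1) ≤ (v - u) ^ (α - 1 - l - 1) :=
      Real.rpow_le_rpow_of_nonpos hw (by linarith [hτ.1]) (by linarith)
    rw [show -α - 1 + (2 * α - 1 - l) = α - 1 - l - 1 by ring, ← hQ] at h0
    rw [mul_div_assoc, ← Real.rpow_sub_one hw.ne']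
    calc _ ≤ 4 * u ^ (α - 2) * (Q * (v - u) ^ (α - 1 - l - 1)) := by
          exact mul_le_mul_of_nonneg_left (h0.trans (by gcongr)) (by positivity)
      _ = _ := by ring

/-- A second interpolation, in the first variable and with `w = p`, is applied to the increment in
the second variable: its size comes from `abs_kernelF_sub_le`, its derivative from
`abs_kernelFu_sub_le`. The exponent `κ` is free, so that the singularity at `p = 0` can be balanced
against the one at `p = u`. -/
theorem abs_kernelF_sub_sub_le (hκ : 0 ≤ κ) (hκ1 : κ ≤ 1) (hl : 0 ≤ l) (hl1 : l ≤ 2 * α - 1)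
    (hs : s ∈ Ioo (0 : ℝ) 1) (hp : 0 < p) (hpu : p ≤ u) (huv : u < v) (hvt : v ≤ t)
    (htL : t ≤ L) :
    |(kernelF α s p v - kernelF α s p t) - (kernelF α s u v - kernelF α s u t)| ≤
      16 * ((1 - s) ^ (l - (2 * α - 1)) * L ^ l) * p ^ (α - 1) * (v - u) ^ (α - 1 - l) *
        ((t - v) / (v - u)) ^ α * ((u - p) / p) ^ κ := by
  have hw := sub_pos.2 huv
  have hs1 : 0 < 1 - s := by linarith [hs.2]
  have hs1' : 1 - s ≤ 1 := by linarith [hs.1]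
  have hL : 0 < L := by linarith
  have hQ1 : 1 ≤ (1 - s) ^ (l - (2 * α - 1)) :=
    Real.one_le_rpow_of_pos_of_le_one_of_nonpos hs1 hs1' (by linarith)
  set Q := (1 - s) ^ (l - (2 * α - 1)) * L ^ l with hQ
  have hQ0 : 0 < Q := by positivity
  have htv : 0 ≤ t - v := sub_nonneg.2 hvt
  set R := ((t - v) / (v - u)) ^ α with hR
  have hR0 : 0 ≤ R := by positivity
  have hRσ : ∀ σ ∈ Icc p u, ((t - v) / (v - σ)) ^ α ≤ R := fun σ hσ => by
    have h1 : v - u ≤ v - σ := by linarith [hσ.2]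
    have h2 : 0 < v - σ := by linarith
    exact Real.rpow_le_rpow (by positivity) (div_le_div_of_nonneg_left htv hw h1) (by linarith)
  have := abs_sub_le_interpolate (f := fun σ => kernelF α s σ v - kernelF α s σ t)
    (f' := fun σ => kernelFu α s σ v - kernelFu α s σ t) (v := p) (t := u)
    (M := 8 * Q * p ^ (α - 1) * (v - u) ^ (α - 1 - l) * R) (w := p) (κ := κ) hpu hp hκ hκ1
    (fun σ hσ => ?_) (fun σ hσ => ?_) (fun σ hσ => ?_)
  · exact this.trans_eq (by ring)
  · have hσ0 : 0 < σ := hp.trans_le hσ.1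
    have hσv : σ < v := hσ.2.trans_lt huv
    exact (hasDerivAt_kernelF_left hs hσ0 hσv).sub
      (hasDerivAt_kernelF_left hs hσ0 (hσv.trans_le hvt))
  · have hσ0 : 0 < σ := hp.trans_le hσ.1
    have hσv : σ < v := hσ.2.trans_lt huv
    have hσv' := sub_pos.2 hσv
    refine (abs_kernelF_sub_le hα hα1 hs hσ0 hσv hvt).trans ?_
    have h1 : (v - σ) ^ (α - 1) ≤ (v - u) ^ (α - 1) :=
      Real.rpow_le_rpow_of_nonpos hw (by linarith [hσ.2]) (by linarith)
    have h2 : σ ^ (α - 1) ≤ p ^ (α - 1) :=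
      Real.rpow_le_rpow_of_nonpos hp hσ.1 (by linarith)
    -- The bound for the size does not need the loss `l`; it is weakened to the form of the bound
    -- for the derivative so that a single constant serves in the interpolation.
    have h3 : (v - u) ^ (α - 1) ≤ Q * (v - u) ^ (α - 1 - l) := by
      have h4 : (v - u) ^ (α - 1) = (v - u) ^ l * (v - u) ^ (α - 1 - l) := by
        rw [← Real.rpow_add hw]; congr 1; ring
      have h5 : (v - u) ^ l ≤ L ^ l := Real.rpow_le_rpow hw.le (by linarith) hl
      rw [h4]
      gcongr
      exact h5.trans (le_mul_of_one_le_left (by positivity) hQ1)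
    calc _ ≤ 4 * p ^ (α - 1) * (Q * (v - u) ^ (α - 1 - l)) * R := by
          gcongr
          · exact h1.trans h3
          · exact hRσ σ hσ
      _ ≤ 8 * p ^ (α - 1) * (Q * (v - u) ^ (α - 1 - l)) * R := by gcongr; norm_num
      _ = _ := by ring
  · have hσ0 : 0 < σ := hp.trans_le hσ.1
    have hσv : σ < v := hσ.2.trans_lt huv
    have hσv' := sub_pos.2 hσv
    refine (abs_kernelFu_sub_le hα hα1 hl hl1 hs hσ0 hσv hvt htL).trans ?_
    have h1 : (v - σ) ^ (α - 1 - l) ≤ (v - u) ^ (α - 1 - l) :=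
      Real.rpow_le_rpow_of_nonpos hw (by linarith [hσ.2]) (by linarith)
    have h2 : σ ^ (α - 2) ≤ p ^ (α - 2) :=
      Real.rpow_le_rpow_of_nonpos hp hσ.1 (by linarith)
    have h3 : p ^ (α - 2) = p ^ (α - 1) / p := by
      rw [← Real.rpow_sub_one hp.ne']; congr 1; ring
    calc _ ≤ 8 * Q * p ^ (α - 2) * (v - u) ^ (α - 1 - l) * R := by
          rw [← hQ]; gcongr; exact hRσ σ hσ
      _ = _ := by rw [h3]; ring

end Differences

/-! ### Measurability of the kernels and operators in their parameters -/

section Measurability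

variable {P : Type*} [MeasurableSpace P]

/-- The moving end points are absorbed into an indicator function on the product space, so that
measurability of parameter integrals over a fixed measure applies. -/
theorem measurable_intervalIntegral {E : Type*} [NormedAddCommGroup E] [NormedSpace ℝ E]
    [MeasurableSpace E] [BorelSpace E] [SecondCountableTopology E]
    {A B : P → ℝ} {F : P → ℝ → E} (hA : Measurable A) (hB : Measurable B)
    (hF : Measurable (Function.uncurry F)) :
    Measurable fun p => ∫ s in A p..B p, F p s := by
  have key : ∀ {A B : P → ℝ}, Measurable A → Measurable B →
      Measurable fun p => ∫ s in Ioc (A p) (B p), F p s := by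
    intro A B hA hB
    have hS : MeasurableSet {q : P × ℝ | A q.1 < q.2 ∧ q.2 ≤ B q.1} :=
      (measurableSet_lt (hA.comp measurable_fst) measurable_snd).inter
        (measurableSet_le measurable_snd (hB.comp measurable_fst))
    have h := (hF.indicator hS).stronglyMeasurable
    have h2 := (StronglyMeasurable.integral_prod_right (ν := volume)
      (f := fun p s => ({q : P × ℝ | A q.1 < q.2 ∧ q.2 ≤ B q.1}.indicator
        (Function.uncurry F)) (p, s)) h).measurable
    have h3 : (fun p => ∫ s in Ioc (A p) (B p), F p s) = fun p => ∫ s,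
        {q : P × ℝ | A q.1 < q.2 ∧ q.2 ≤ B q.1}.indicator (Function.uncurry F) (p, s) := by
      funext p
      rw [← integral_indicator measurableSet_Ioc]
      rfl
    rw [h3]
    exact h2
  exact (key hA hB).sub (key hB hA)

theorem measurable_kernelG (α : ℝ) {θ ξ η : P → ℝ} (hθ : Measurable θ) (hξ : Measurable ξ)
    (hη : Measurable η) : Measurable fun p => kernelG α (θ p) (ξ p) (η p) := by
  unfold kernelG
  refine Measurable.mul (by fun_prop) (measurable_intervalIntegral measurable_const
    measurable_const ?_)
  unfold Function.uncurry
  fun_prop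

theorem measurable_weylRight (δ : ℝ) {b t : P → ℝ} {F : P → ℝ → ℂ} (hb : Measurable b)
    (ht : Measurable t) (hF : Measurable (Function.uncurry F)) :
    Measurable fun p => weylRight δ (b p) (F p) (t p) := by
  have h1 : Measurable fun p => F p (t p) := hF.comp (measurable_id.prodMk ht)
  have h2 : Measurable fun p => ∫ s in (t p)..(b p),
      (F p (t p) - F p s) / ((s - t p) ^ (δ + 1) : ℝ) := by
    refine measurable_intervalIntegral ht hb ?_
    have h3 : Measurable fun q : P × ℝ => F q.1 q.2 := hF
    unfold Function.uncurry
    fun_prop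
  unfold weylRight
  fun_prop

theorem measurable_weylLeft (δ : ℝ) {a t : P → ℝ} {F : P → ℝ → ℂ} (ha : Measurable a)
    (ht : Measurable t) (hF : Measurable (Function.uncurry F)) :
    Measurable fun p => weylLeft δ (a p) (F p) (t p) := by
  have h1 : Measurable fun p => F p (t p) := hF.comp (measurable_id.prodMk ht)
  have h2 : Measurable fun p => ∫ s in (a p)..(t p),
      (F p (t p) - F p s) / ((t p - s) ^ (δ + 1) : ℝ) := by
    refine measurable_intervalIntegral ha ht ?_
    have h3 : Measurable fun q : P × ℝ => F q.1 q.2 := hF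
    unfold Function.uncurry
    fun_prop
  unfold weylLeft
  fun_prop

theorem measurable_kernelK (α ε : ℝ) {θ b ξ η : P → ℝ} (hθ : Measurable θ) (hb : Measurable b)
    (hξ : Measurable ξ) (hη : Measurable η) :
    Measurable fun p => kernelK α ε (θ p) (b p) (ξ p) (η p) := by
  unfold kernelK
  refine (measurable_weylLeft _ hθ hξ ?_).neg
  refine measurable_weylRight (P := P × ℝ) (α - ε) (b := fun q => b q.1) (t := fun q => η q.1)
    (F := fun q η' => ((kernelG α (θ q.1) q.2 η' - kernelG α (θ q.1) q.2 (b q.1) : ℝ) : ℂ))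
    (by fun_prop) (by fun_prop) ?_
  exact Complex.measurable_ofReal.comp ((measurable_kernelG α (by fun_prop) (by fun_prop)
    (by fun_prop)).sub (measurable_kernelG α (by fun_prop) (by fun_prop) (by fun_prop)))

theorem measurable_gammaOp (γ : ℝ) {ψ : ℝ → ℝ → ℝ} (hψ : Measurable (Function.uncurry ψ))
    {ξ η : P → ℝ} (hξ : Measurable ξ) (hη : Measurable η) :
    Measurable fun p => gammaOp γ ψ (ξ p) (η p) := by
  unfold gammaOp
  refine measurable_weylRight _ hη hξ ?_
  refine measurable_weylLeft (P := P × ℝ) (1 - γ) (a := fun q => q.2) (t := fun q => η q.1)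
    (F := fun q η' => ((ψ q.2 η' : ℝ) : ℂ)) (by fun_prop) (by fun_prop) ?_
  have h : Measurable fun q : ℝ × ℝ => ψ q.1 q.2 := hψ
  exact Complex.measurable_ofReal.comp (h.comp ((by fun_prop : Measurable
    fun q : (P × ℝ) × ℝ => (q.1.2, q.2))))

theorem measurable_bigLambda (α : ℝ) {x z : ℝ → ℝ} (hx : Measurable x) (hz : Measurable z)
    (a c : ℝ) : Measurable fun r => bigLambda α x z a r c := by
  have h2 : Measurable fun r => ∫ θ in a..r,
      (z r - z θ) * (x θ - x r) / (r - θ) ^ (α + 1) := by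
    refine measurable_intervalIntegral measurable_const measurable_id ?_
    unfold Function.uncurry
    fun_prop
  unfold bigLambda
  fun_prop

end Measurability

/-! ### Increments of the kernel `G` -/

theorem eulerWeight_nonneg {α s : ℝ} (hs : s ∈ Ioo (0 : ℝ) 1) : 0 ≤ eulerWeight α s := by
  have h1 : 0 < 1 - s := by linarith [hs.2]
  have h0 := hs.1
  unfold eulerWeight; positivity

theorem eulerWeight_eq (α s : ℝ) :
    eulerWeight α s = (s - 0) ^ (1 - α - 1) * (1 - s) ^ (2 * α - 1 - 1) := by
  unfold eulerWeight; rw [sub_zero]; congr 2 <;> ring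

/-- The loss in `1-s` from `rpow_denominator_le` turns the weight into a Beta weight with exponents
`1-α` and `l`, integrable precisely because `l > 0`. -/
theorem eulerWeight_mul_rpow {α s l : ℝ} (hs : s ∈ Ioo (0 : ℝ) 1) :
    eulerWeight α s * (1 - s) ^ (l - (2 * α - 1)) = (s - 0) ^ (1 - α - 1) * (1 - s) ^ (l - 1) := by
  rw [eulerWeight_eq, mul_assoc, ← Real.rpow_add (by linarith [hs.2])]; congr 2; ring

section KernelG

variable {α : ℝ} (hα : 1 / 2 < α) (hα1 : α < 1)
include hα hα1

theorem intervalIntegrable_eulerWeight_mul_kernelF {u v : ℝ} (hu : 0 < u) (huv : u < v) :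
    IntervalIntegrable (fun s => eulerWeight α s * kernelF α s u v) volume 0 1 := by
  have hw := sub_pos.2 huv
  refine intervalIntegrable_of_le_beta (p := 1 - α) (q := 2 * α - 1)
    (M := u ^ (α - 1) * (v - u) ^ (α - 1)) zero_le_one (by linarith) (by linarith) (by linarith)
    (by linarith) (by positivity) ?_ fun s hs => ?_
  · have : Measurable fun s => eulerWeight α s * kernelF α s u v := by
      unfold eulerWeight kernelF; fun_prop
    exact this.aestronglyMeasurable
  · rw [norm_mul, Real.norm_of_nonneg (eulerWeight_nonneg hs), ← eulerWeight_eq, mul_comm]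
    exact mul_le_mul_of_nonneg_right (abs_kernelF_le hα hα1 hs hu huv) (eulerWeight_nonneg hs)

theorem exists_abs_kernelG_sub_le : ∃ C : ℝ, 0 ≤ C ∧ ∀ θ ξ η t : ℝ, θ < ξ → ξ < η → η ≤ t →
    |kernelG α θ ξ η - kernelG α θ ξ t| ≤
      C * ((ξ - θ) ^ (α - 1) * (η - ξ) ^ (-1 : ℝ) * (t - η) ^ α) := by
  have hB := betaConst_nonneg (p := 1 - α) (q := 2 * α - 1) (by linarith) (by linarith)
  refine ⟨|1 / (α * Real.Gamma α * Real.Gamma (2 * α - 1))| *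
    (4 * betaConst (1 - α) (2 * α - 1)), by positivity, fun θ ξ η t h1 h2 h3 => ?_⟩
  have hu : 0 < ξ - θ := sub_pos.2 h1
  have hw : 0 < η - ξ := sub_pos.2 h2
  have ht : 0 ≤ t - η := sub_nonneg.2 h3
  have huv : ξ - θ < η - θ := by linarith
  have hut : ξ - θ < t - θ := by linarith
  rw [kernelG_eq h1 h2, kernelG_eq h1 (h2.trans_le h3), ← mul_sub,
    ← intervalIntegral.integral_sub (intervalIntegrable_eulerWeight_mul_kernelF hα hα1 hu huv)
      (intervalIntegrable_eulerWeight_mul_kernelF hα hα1 hu hut), abs_mul]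
  generalize 1 / (α * Real.Gamma α * Real.Gamma (2 * α - 1)) = c
  rw [mul_assoc]
  refine mul_le_mul_of_nonneg_left ?_ (abs_nonneg _)
  rw [← Real.norm_eq_abs]
  refine (norm_integral_le_betaConst (p := 1 - α) (q := 2 * α - 1)
    (M := 4 * ((ξ - θ) ^ (α - 1) * (η - ξ) ^ (-1 : ℝ) * (t - η) ^ α)) zero_lt_one (by linarith)
    (by linarith) (by linarith) (by linarith) (by positivity) fun s hs => ?_).trans_eq ?_
  · rw [← mul_sub, norm_mul, Real.norm_of_nonneg (eulerWeight_nonneg hs), ← eulerWeight_eq,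
      mul_comm]
    refine mul_le_mul_of_nonneg_right ?_ (eulerWeight_nonneg hs)
    refine (abs_kernelF_sub_le hα hα1 hs hu huv (by linarith)).trans_eq ?_
    rw [show t - θ - (η - θ) = t - η by ring, show η - θ - (ξ - θ) = η - ξ by ring,
      Real.div_rpow ht hw.le, Real.rpow_sub_one hw.ne', Real.rpow_neg_one]
    field_simp
  · rw [sub_zero, Real.one_rpow]; ring

/-- All four kernels carry the same weight in `s`, so the double increment passes under the integral
and is estimated for fixed `s`. -/
theorem exists_abs_kernelG_sub_sub_le {l κ : ℝ} (hl : 0 < l) (hl1 : l ≤ 2 * α - 1) (hκ : 0 ≤ κ)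
    (hκ1 : κ ≤ 1) : ∃ C : ℝ, 0 ≤ C ∧ ∀ θ p ξ η t b : ℝ, θ < p → p ≤ ξ → ξ < η → η ≤ t → t ≤ b →
    |(kernelG α θ p η - kernelG α θ p t) - (kernelG α θ ξ η - kernelG α θ ξ t)| ≤
      C * ((b - θ) ^ l * (p - θ) ^ (α - 1 - κ) * (ξ - p) ^ κ * (η - ξ) ^ (-1 - l) *
        (t - η) ^ α) := by
  have hB := betaConst_nonneg (p := 1 - α) (q := l) (by linarith) (by linarith)
  refine ⟨|1 / (α * Real.Gamma α * Real.Gamma (2 * α - 1))| *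
    (16 * betaConst (1 - α) l), by positivity, fun θ p ξ η t b h0 h1 h2 h3 h4 => ?_⟩
  have hp : 0 < p - θ := sub_pos.2 h0
  have hw : 0 < η - ξ := sub_pos.2 h2
  have ht : 0 ≤ t - η := sub_nonneg.2 h3
  have hx : 0 ≤ ξ - p := sub_nonneg.2 h1
  have hb : 0 < b - θ := by linarith
  have int : ∀ {p t : ℝ}, θ < p → p < t → IntervalIntegrable
      (fun s => eulerWeight α s * kernelF α s (p - θ) (t - θ)) volume 0 1 := fun h h' =>
    intervalIntegrable_eulerWeight_mul_kernelF hα hα1 (sub_pos.2 h) (by linarith)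
  have i1 := int h0 (h1.trans_lt h2)
  have i2 := int h0 ((h1.trans_lt h2).trans_le h3)
  have i3 := int (h0.trans_le h1) h2
  have i4 := int (h0.trans_le h1) (h2.trans_le h3)
  rw [kernelG_eq h0 (h1.trans_lt h2), kernelG_eq h0 ((h1.trans_lt h2).trans_le h3),
    kernelG_eq (h0.trans_le h1) h2, kernelG_eq (h0.trans_le h1) (h2.trans_le h3), ← mul_sub,
    ← mul_sub, ← mul_sub, ← intervalIntegral.integral_sub i1 i2,
    ← intervalIntegral.integral_sub i3 i4, ← intervalIntegral.integral_sub (i1.sub i2) (i3.sub i4),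
    abs_mul]
  generalize 1 / (α * Real.Gamma α * Real.Gamma (2 * α - 1)) = c
  rw [mul_assoc]
  refine mul_le_mul_of_nonneg_left ?_ (abs_nonneg _)
  rw [← Real.norm_eq_abs]
  refine (norm_integral_le_betaConst (p := 1 - α) (q := l)
    (M := 16 * ((b - θ) ^ l * (p - θ) ^ (α - 1 - κ) * (ξ - p) ^ κ * (η - ξ) ^ (-1 - l) *
        (t - η) ^ α)) zero_lt_one (by linarith)
    (by linarith) (by linarith) (by linarith) (by positivity) fun s hs => ?_).trans_eq ?_
  · rw [← mul_sub, ← mul_sub, ← mul_sub, norm_mul, Real.norm_of_nonneg (eulerWeight_nonneg hs),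
      ← eulerWeight_mul_rpow hs]
    refine (mul_le_mul_of_nonneg_left (abs_kernelF_sub_sub_le hα hα1 hκ hκ1 hl.le hl1 hs hp
      (u := ξ - θ) (v := η - θ) (t := t - θ) (L := b - θ) (by linarith) (by linarith)
      (by linarith) (by linarith)) (eulerWeight_nonneg hs)).trans_eq ?_
    rw [show t - θ - (η - θ) = t - η by ring, show η - θ - (ξ - θ) = η - ξ by ring,
      show ξ - θ - (p - θ) = ξ - p by ring, Real.div_rpow ht hw.le, Real.div_rpow hx hp.le]
    have e1 : (η - ξ) ^ (-1 - l) = (η - ξ) ^ (α - 1 - l) / (η - ξ) ^ α := by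
      rw [← Real.rpow_sub hw]; congr 1; ring
    rw [e1, Real.rpow_sub hp (α - 1) κ]
    field_simp
  · rw [sub_zero, Real.one_rpow]; ring

end KernelG

/-! ### The bound for the kernel `K` -/

section KernelK

/-- Lets the increment in `ξ` of the inner derivative be treated as the inner derivative of the
increment, to which the double increment bound applies. -/
theorem weylRight_sub {δ b t : ℝ} {f g : ℝ → ℂ}
    (hf : IntervalIntegrable (fun s => (f t - f s) / ((s - t) ^ (δ + 1) : ℝ)) volume t b)
    (hg : IntervalIntegrable (fun s => (g t - g s) / ((s - t) ^ (δ + 1) : ℝ)) volume t b) :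
    weylRight δ b f t - weylRight δ b g t = weylRight δ b (fun s => f s - g s) t := by
  have : (∫ s in t..b, (f t - g t - (f s - g s)) / (((s - t) ^ (δ + 1) : ℝ) : ℂ)) =
      (∫ s in t..b, (f t - f s) / (((s - t) ^ (δ + 1) : ℝ) : ℂ)) -
        ∫ s in t..b, (g t - g s) / (((s - t) ^ (δ + 1) : ℝ) : ℂ) := by
    rw [← intervalIntegral.integral_sub hf hg]
    congr 1; ext s; ring
  unfold weylRight
  rw [this]; ring

theorem intervalIntegrable_weylRight {δ b t p M : ℝ} {f : ℝ → ℂ} (htb : t ≤ b)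
    (hp : 0 < p) (hp1 : p ≤ 1) (hM : 0 ≤ M) (hf : Measurable f)
    (h : ∀ s ∈ Ioo t b, ‖f t - f s‖ ≤ M * (s - t) ^ (δ + p)) :
    IntervalIntegrable (fun s => (f t - f s) / ((s - t) ^ (δ + 1) : ℝ)) volume t b := by
  refine intervalIntegrable_of_le_beta (p := p) (q := 1) (M := M) htb hp hp1 one_pos le_rfl hM ?_
    fun s hs => ?_
  · have : Measurable fun s => (f t - f s) / (((s - t) ^ (δ + 1) : ℝ) : ℂ) := by fun_prop
    exact this.aestronglyMeasurable
  · have hs' : 0 < s - t := sub_pos.2 hs.1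
    rw [norm_div, Complex.norm_real, Real.norm_of_nonneg (by positivity),
      div_le_iff₀ (by positivity), sub_self, Real.rpow_zero, mul_one, mul_assoc,
      ← Real.rpow_add hs', show p - 1 + (δ + 1) = δ + p by ring]
    exact h s hs

/-- The inner derivative, of order `α-ε`, of a function with increments of order `α` in `η` gives
`(b-η)^ε`; subtracting `G(θ,ξ,b)` gives the boundary term this same order. The outer derivative is
controlled by the double increments of `G`. -/
theorem exists_norm_kernelK_le {α ε l : ℝ} (hα : 1 / 2 < α) (hα1 : α < 1) (hε : 0 < ε)
    (hεα : ε < α) (hl : 0 < l) (hl1 : l ≤ 2 * α - 1) :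
    ∃ C : ℝ, 0 ≤ C ∧ ∀ θ ξ η b : ℝ, θ < ξ → ξ < η → η < b →
      ‖kernelK α ε θ b ξ η‖ ≤
        C * ((b - θ) ^ l * (ξ - θ) ^ (ε - 1) * (η - ξ) ^ (-1 - l) * (b - η) ^ ε) := by
  obtain ⟨C₁, hC₁, H₁⟩ := exists_abs_kernelG_sub_le hα hα1
  obtain ⟨C₂, hC₂, H₂⟩ := exists_abs_kernelG_sub_sub_le hα hα1 hl hl1
    -- Since `κ - (α-ε) = ε/2` and `α - κ = ε/2`, the integral of the outer derivative is a Beta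
    -- integral with both exponents `ε/2`, and it produces `(ξ-θ)^(ε-1)`.
    (κ := α - ε / 2) (by linarith) (by linarith)
  have hW := weylConst_nonneg (δ := α - ε) (p := ε) (q := 1) (by linarith) (by linarith) hε one_pos
  have hW2 := weylConst_nonneg (δ := α - ε) (p := ε / 2) (q := ε / 2) (by linarith) (by linarith)
    (by linarith) (by linarith)
  refine ⟨weylConst (α - ε) (ε / 2) (ε / 2) * (weylConst (α - ε) ε 1 * (C₁ + C₂)), by positivity,
    fun θ ξ η b h1 h2 h3 => ?_⟩
  have hu : 0 < ξ - θ := sub_pos.2 h1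
  have hw : 0 < η - ξ := sub_pos.2 h2
  have hb : 0 < b - η := sub_pos.2 h3
  have hL : 0 < b - θ := by linarith
  set g : ℝ → ℝ → ℂ := fun ξ' η' => ((kernelG α θ ξ' η' - kernelG α θ ξ' b : ℝ) : ℂ) with hg
  have gsub : ∀ p s t, g p s - g p t = ((kernelG α θ p s - kernelG α θ p t : ℝ) : ℂ) :=
    fun p s t => by simp only [hg]; push_cast; ring
  have gmeas : ∀ p, Measurable (g p) := fun p => Complex.measurable_ofReal.comp
    ((measurable_kernelG α measurable_const measurable_const measurable_id).sub measurable_const)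
  have gint : ∀ p, θ < p → p < η → IntervalIntegrable
      (fun s => (g p η - g p s) / ((s - η) ^ ((α - ε) + 1) : ℝ)) volume η b := by
    intro p hp hpη
    have hp' : 0 < p - θ := sub_pos.2 hp
    have hpη' : 0 < η - p := sub_pos.2 hpη
    refine intervalIntegrable_weylRight (p := ε)
      (M := C₁ * ((p - θ) ^ (α - 1) * (η - p) ^ (-1 : ℝ))) h3.le hε (by linarith)
      (by positivity) (gmeas p) fun s hs => ?_
    rw [gsub, Complex.norm_real, sub_add_cancel, Real.norm_eq_abs]
    exact (H₁ θ p η s hp hpη hs.1.le).trans_eq (by ring)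
  unfold kernelK
  rw [norm_neg]
  set M := weylConst (α - ε) ε 1 * (C₁ + C₂) *
    ((b - θ) ^ l * (η - ξ) ^ (-1 - l) * (b - η) ^ ε) with hM
  refine (norm_weylLeft_le (p := ε / 2) (q := ε / 2) (M := M) (by linarith) (by linarith) h1
    (by linarith) (by linarith) (by linarith) (by linarith) (by positivity) ?_
    fun p hp => ?_).trans_eq ?_
  · refine (norm_weylRight_le (p := ε) (q := 1)
      (M := C₁ * ((ξ - θ) ^ (α - 1) * (η - ξ) ^ (-1 : ℝ))) (by linarith) (by linarith) h3 hε
      (by linarith) one_pos le_rfl (by positivity) ?_ fun s hs => ?_).trans ?_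
    · rw [Complex.norm_real, Real.norm_eq_abs, show α - ε + ε + 1 - 1 = α by ring]
      exact (H₁ θ ξ η b h1 h2 h3.le).trans_eq (by ring)
    · have := gsub ξ η s
      simp only [hg] at this
      rw [this, Complex.norm_real, Real.norm_eq_abs, sub_add_cancel, sub_self, Real.rpow_zero,
        mul_one]
      exact (H₁ θ ξ η s h1 h2 hs.1.le).trans_eq (by ring)
    · have e1 : (η - ξ) ^ (-1 : ℝ) ≤ (b - θ) ^ l * (η - ξ) ^ (-1 - l) := by
        have e2 : (η - ξ) ^ (-1 : ℝ) = (η - ξ) ^ l * (η - ξ) ^ (-1 - l) := by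
          rw [← Real.rpow_add hw]; congr 1; ring
        have e3 : (η - ξ) ^ l ≤ (b - θ) ^ l := Real.rpow_le_rpow hw.le (by linarith) hl.le
        rw [e2]; gcongr
      rw [show ε + 1 - 1 = ε by ring, show α - ε + ε / 2 + ε / 2 - 1 = α - 1 by ring, hM]
      calc _ ≤ weylConst (α - ε) ε 1 * ((C₁ + C₂) * ((ξ - θ) ^ (α - 1) *
            ((b - θ) ^ l * (η - ξ) ^ (-1 - l)))) * (b - η) ^ ε := by
              gcongr; linarith
        _ = _ := by ring
  · have hp' : 0 < p - θ := sub_pos.2 hp.1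
    have hpξ : 0 < ξ - p := sub_pos.2 hp.2
    have hsub : ∀ s, g p s - g ξ s = ((kernelG α θ p s - kernelG α θ p b -
        (kernelG α θ ξ s - kernelG α θ ξ b) : ℝ) : ℂ) := fun s => by
      simp only [hg]; push_cast; ring
    have hsub2 : ∀ s, (g p η - g ξ η) - (g p s - g ξ s) = ((kernelG α θ p η - kernelG α θ p s -
        (kernelG α θ ξ η - kernelG α θ ξ s) : ℝ) : ℂ) := fun s => by
      simp only [hg]; push_cast; ring
    change ‖weylRight (α - ε) b (g ξ) η - weylRight (α - ε) b (g p) η‖ ≤ _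
    rw [norm_sub_rev, weylRight_sub (gint p hp.1 (hp.2.trans h2)) (gint ξ h1 h2)]
    refine (norm_weylRight_le (p := ε) (q := 1)
      (M := C₂ * ((b - θ) ^ l * (p - θ) ^ (ε / 2 - 1) * (ξ - p) ^ (α - ε / 2) *
        (η - ξ) ^ (-1 - l))) (by linarith) (by linarith) h3 hε
      (by linarith) one_pos le_rfl (by positivity) ?_ fun s hs => ?_).trans ?_
    · rw [hsub, Complex.norm_real, Real.norm_eq_abs, show α - ε + ε + 1 - 1 = α by ring]
      refine (H₂ θ p ξ η b b hp.1 hp.2.le h2 h3.le le_rfl).trans_eq ?_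
      rw [show α - 1 - (α - ε / 2) = ε / 2 - 1 by ring]; ring
    · rw [hsub2, Complex.norm_real, Real.norm_eq_abs, sub_add_cancel, sub_self, Real.rpow_zero,
        mul_one]
      refine (H₂ θ p ξ η s b hp.1 hp.2.le h2 hs.1.le hs.2.le).trans_eq ?_
      rw [show α - 1 - (α - ε / 2) = ε / 2 - 1 by ring]; ring
    · rw [show ε + 1 - 1 = ε by ring, show α - ε + ε / 2 = α - ε / 2 by ring, hM]
      calc _ ≤ weylConst (α - ε) ε 1 * ((C₁ + C₂) * ((b - θ) ^ l * (p - θ) ^ (ε / 2 - 1) *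
            (ξ - p) ^ (α - ε / 2) * (η - ξ) ^ (-1 - l))) * (b - η) ^ ε := by
              gcongr; linarith
        _ = _ := by ring
  · rw [hM, show ε / 2 + ε / 2 - 1 = ε - 1 by ring]; ring

end KernelK

/-! ### The operator `Γ` on multiplicative functionals -/

section GammaOp

theorem weylLeft_ofReal (δ a t : ℝ) (f : ℝ → ℝ) :
    weylLeft δ a (fun s => (f s : ℂ)) t = ((1 / Real.Gamma (1 - δ) * (f t / (t - a) ^ δ
      + δ * ∫ s in a..t, (f t - f s) / (t - s) ^ (δ + 1)) : ℝ) : ℂ) := by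
  have : (∫ s in a..t, ((f t : ℂ) - (f s : ℂ)) / (((t - s) ^ (δ + 1) : ℝ) : ℂ)) =
      ((∫ s in a..t, (f t - f s) / (t - s) ^ (δ + 1) : ℝ) : ℂ) := by
    rw [← intervalIntegral.integral_ofReal]; congr 1; ext s; push_cast; rfl
  unfold weylLeft
  rw [this]; push_cast; rfl

variable {β δ ξ η X Y W : ℝ} {x y : ℝ → ℝ} {ψ : ℝ → ℝ → ℝ}

/-- Quantitative form on `[ξ, η]` of the properties of a multiplicative functional. -/
structure MultiplicativeBound (β ξ η X Y W : ℝ) (x y : ℝ → ℝ) (ψ : ℝ → ℝ → ℝ) : Prop where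
  nonneg_left : 0 ≤ X
  nonneg_right : 0 ≤ Y
  nonneg : 0 ≤ W
  left : ∀ s t, ξ ≤ s → s ≤ t → t ≤ η → |x t - x s| ≤ X * (t - s) ^ β
  right : ∀ s t, ξ ≤ s → s ≤ t → t ≤ η → |y t - y s| ≤ Y * (t - s) ^ β
  bound : ∀ s t, ξ ≤ s → s ≤ t → t ≤ η → |ψ s t| ≤ W * (t - s) ^ (2 * β)
  mul : ∀ s u t, ξ ≤ s → s ≤ u → u ≤ t → t ≤ η →
    ψ s u + ψ u t + (x u - x s) * (y t - y u) = ψ s t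
  meas : ∀ s, ξ ≤ s → s ≤ η → AEStronglyMeasurable (ψ s) (volume.restrict (Ioc s η))

namespace MultiplicativeBound

theorem restrict (h : MultiplicativeBound β ξ η X Y W x y ψ) {ξ' η' : ℝ} (hξ : ξ ≤ ξ')
    (hη : η' ≤ η) : MultiplicativeBound β ξ' η' X Y W x y ψ where
  nonneg_left := h.nonneg_left
  nonneg_right := h.nonneg_right
  nonneg := h.nonneg
  left := fun s t h1 h2 h3 => h.left s t (hξ.trans h1) h2 (h3.trans hη)
  right := fun s t h1 h2 h3 => h.right s t (hξ.trans h1) h2 (h3.trans hη)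
  bound := fun s t h1 h2 h3 => h.bound s t (hξ.trans h1) h2 (h3.trans hη)
  mul := fun s u t h1 h2 h3 h4 => h.mul s u t (hξ.trans h1) h2 h3 (h4.trans hη)
  meas := fun s h1 h2 => (h.meas s (hξ.trans h1) (h2.trans hη)).mono_measure
    (Measure.restrict_mono (Ioc_subset_Ioc_right hη) le_rfl)

variable (hβ : 0 ≤ β) (h : MultiplicativeBound β ξ η X Y W x y ψ)
include h

theorem abs_sub_mul_sub_le {s u v w : ℝ} (h1 : ξ ≤ s) (h2 : s ≤ u) (h3 : u ≤ η) (h4 : ξ ≤ v)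
    (h5 : v ≤ w) (h6 : w ≤ η) :
    |(x u - x s) * (y w - y v)| ≤ X * Y * ((u - s) ^ β * (w - v) ^ β) := by
  rw [abs_mul]
  have := h.nonneg_left
  have hs : 0 ≤ (u - s) ^ β := Real.rpow_nonneg (by linarith) _
  calc _ ≤ (X * (u - s) ^ β) * (Y * (w - v) ^ β) :=
        mul_le_mul (h.left s u h1 h2 h3) (h.right v w h4 h5 h6) (abs_nonneg _) (by positivity)
    _ = _ := by ring

include hβ

/-- One of the two orders `β` is given up to the length of the interval, because increments of `ψ`
in one variable have order only `β`. -/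
theorem abs_le_mul_rpow {s t : ℝ} (h1 : ξ ≤ s) (h2 : s < t) (h3 : t ≤ η) :
    |ψ s t| ≤ W * (η - ξ) ^ β * (t - s) ^ β := by
  have hts : 0 < t - s := sub_pos.2 h2
  have := h.nonneg
  refine (h.bound s t h1 h2.le h3).trans ?_
  rw [two_mul, Real.rpow_add hts, ← mul_assoc]
  have : (t - s) ^ β ≤ (η - ξ) ^ β := Real.rpow_le_rpow hts.le (by linarith) hβ
  gcongr

/-- The increment of `ψ s ·` up to the right end point. -/
theorem abs_sub_right_le {s u : ℝ} (h1 : ξ ≤ s) (h2 : s ≤ u) (h3 : u < η) :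
    |ψ s η - ψ s u| ≤ (W + X * Y) * (η - ξ) ^ β * (η - u) ^ β := by
  -- Multiplicativity writes the increment as a value on the short interval `[u,η]` plus a product
  -- that already contains an increment of `y` over it.
  have e : ψ s η - ψ s u = ψ u η + (x u - x s) * (y η - y u) := by
    rw [← h.mul s u η h1 h2 h3.le le_rfl]; ring
  have hXY := mul_nonneg h.nonneg_left h.nonneg_right
  have hηu : 0 < η - u := sub_pos.2 h3
  have h4 : (u - s) ^ β ≤ (η - ξ) ^ β := Real.rpow_le_rpow (by linarith) (by linarith) hβ
  rw [e]
  calc _ ≤ |ψ u η| + |(x u - x s) * (y η - y u)| := abs_add_le _ _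
    _ ≤ W * (η - ξ) ^ β * (η - u) ^ β + X * Y * ((η - ξ) ^ β * (η - u) ^ β) := by
        refine add_le_add (h.abs_le_mul_rpow hβ (h1.trans h2) h3 le_rfl) ?_
        refine (h.abs_sub_mul_sub_le h1 h2 h3.le (h1.trans h2) h3.le le_rfl).trans ?_
        gcongr
    _ = _ := by ring

theorem abs_sub_left_le {s : ℝ} (h1 : ξ < s) (h2 : s < η) :
    |ψ ξ η - ψ s η| ≤ (W + X * Y) * (η - ξ) ^ β * (s - ξ) ^ β := by
  have e : ψ ξ η - ψ s η = ψ ξ s + (x s - x ξ) * (y η - y s) := by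
    rw [← h.mul ξ s η le_rfl h1.le h2.le le_rfl]; ring
  have hXY := mul_nonneg h.nonneg_left h.nonneg_right
  have h3 : (η - s) ^ β ≤ (η - ξ) ^ β := Real.rpow_le_rpow (by linarith) (by linarith) hβ
  have h4 : 0 < s - ξ := sub_pos.2 h1
  rw [e]
  calc _ ≤ |ψ ξ s| + |(x s - x ξ) * (y η - y s)| := abs_add_le _ _
    _ ≤ W * (η - ξ) ^ β * (s - ξ) ^ β + X * Y * ((s - ξ) ^ β * (η - ξ) ^ β) := by
        refine add_le_add (h.abs_le_mul_rpow hβ le_rfl h1 h2.le) ?_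
        refine (h.abs_sub_mul_sub_le le_rfl h1.le h2.le h1.le h2.le le_rfl).trans ?_
        gcongr
    _ = _ := by ring

theorem abs_quotient_le {s u : ℝ} (h1 : ξ ≤ s) (h2 : s ≤ u) (h3 : u < η) :
    |(ψ s η - ψ s u) / (η - u) ^ (δ + 1)| ≤
      (W + X * Y) * (η - ξ) ^ β * (η - u) ^ (β - δ - 1) := by
  have hηu : 0 < η - u := sub_pos.2 h3
  rw [abs_div, abs_of_nonneg (show 0 ≤ (η - u) ^ (δ + 1) by positivity),
    div_le_iff₀ (by positivity), mul_assoc _ _ ((η - u) ^ (δ + 1)), ← Real.rpow_add hηu,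
    show β - δ - 1 + (δ + 1) = β by ring]
  exact h.abs_sub_right_le hβ h1 h2 h3

theorem intervalIntegrable_quotient {s : ℝ} (hδβ : δ < β) (hβδ : β ≤ 1 + δ) (h1 : ξ ≤ s)
    (h2 : s < η) :
    IntervalIntegrable (fun u => (ψ s η - ψ s u) / (η - u) ^ (δ + 1)) volume s η := by
  have := h.nonneg
  have := h.nonneg_left
  have := h.nonneg_right
  have hη : 0 < η - ξ := by linarith
  refine intervalIntegrable_of_le_beta (p := 1) (q := β - δ) (M := (W + X * Y) * (η - ξ) ^ β)
    h2.le one_pos le_rfl (by linarith) (by linarith) (by positivity) ?_ fun u hu => ?_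
  · have h3 : Measurable fun u : ℝ => (η - u) ^ (δ + 1) := by fun_prop
    simp_rw [div_eq_mul_inv]
    exact (aestronglyMeasurable_const.sub (h.meas s h1 h2.le)).mul h3.inv.aestronglyMeasurable
  · rw [Real.norm_eq_abs, sub_self, Real.rpow_zero, one_mul]
    exact h.abs_quotient_le hβ h1 hu.1.le hu.2

/-- The boundary terms in the increment of the inner Weyl derivative. -/
theorem abs_boundary_sub_le {s : ℝ} (hδ : 0 < δ) (hδ1 : δ < 1) (hβ1 : β ≤ 1) (h1 : ξ < s)
    (h2 : s < η) :
    |ψ ξ η / (η - ξ) ^ δ - ψ s η / (η - s) ^ δ| ≤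
      2 * ((W + X * Y) * (η - ξ) ^ β * ((s - ξ) ^ β * (η - s) ^ (-δ))) := by
  have hW := h.nonneg
  have hXY := mul_nonneg h.nonneg_left h.nonneg_right
  have hL : 0 < η - ξ := by linarith
  have hs : 0 < η - s := sub_pos.2 h2
  have hsξ : 0 < s - ξ := sub_pos.2 h1
  have e : ψ ξ η / (η - ξ) ^ δ - ψ s η / (η - s) ^ δ =
      (ψ ξ η - ψ s η) * (η - s) ^ (-δ) - ψ ξ η * ((η - s) ^ (-δ) - (η - ξ) ^ (-δ)) := by
    rw [Real.rpow_neg hs.le, Real.rpow_neg hL.le]; ring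
  have e1 : |(ψ ξ η - ψ s η) * (η - s) ^ (-δ)| ≤
      (W + X * Y) * (η - ξ) ^ β * ((s - ξ) ^ β * (η - s) ^ (-δ)) := by
    rw [abs_mul, abs_of_nonneg (show 0 ≤ (η - s) ^ (-δ) by positivity), ← mul_assoc]
    exact mul_le_mul_of_nonneg_right (h.abs_sub_left_le hβ h1 h2) (by positivity)
  -- With `ρ = (η-s)/(η-ξ)` in `(0,1)`, the chain `1 - ρ^δ ≤ 1 - ρ ≤ (1-ρ)^β` applies, using `δ ≤ 1`
  -- and `β ≤ 1`.
  have e2 : |(η - s) ^ (-δ) - (η - ξ) ^ (-δ)| ≤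
      (η - s) ^ (-δ) * ((s - ξ) / (η - ξ)) ^ β := by
    have f1 : (η - ξ) ^ (-δ) ≤ (η - s) ^ (-δ) :=
      Real.rpow_le_rpow_of_nonpos hs (by linarith) (by linarith)
    have f2 : (η - ξ) ^ (-δ) = (η - s) ^ (-δ) * ((η - s) / (η - ξ)) ^ δ := by
      rw [Real.div_rpow hs.le hL.le, Real.rpow_neg hs.le, Real.rpow_neg hL.le]
      field_simp
    have f3 : (η - s) / (η - ξ) ≤ ((η - s) / (η - ξ)) ^ δ := by
      simpa using Real.rpow_le_rpow_of_exponent_ge (x := (η - s) / (η - ξ)) (by positivity)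
        ((div_le_one hL).2 (by linarith)) hδ1.le
    have f4 : (s - ξ) / (η - ξ) ≤ ((s - ξ) / (η - ξ)) ^ β := by
      simpa using Real.rpow_le_rpow_of_exponent_ge (x := (s - ξ) / (η - ξ)) (by positivity)
        ((div_le_one hL).2 (by linarith)) hβ1
    have f5 : (s - ξ) / (η - ξ) = 1 - (η - s) / (η - ξ) := by field_simp; ring
    rw [abs_of_nonneg (by linarith), f2]
    calc _ = (η - s) ^ (-δ) * (1 - ((η - s) / (η - ξ)) ^ δ) := by ring
      _ ≤ _ := by gcongr; linarith
  have e3 : |ψ ξ η * ((η - s) ^ (-δ) - (η - ξ) ^ (-δ))| ≤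
      (W + X * Y) * (η - ξ) ^ β * ((s - ξ) ^ β * (η - s) ^ (-δ)) := by
    have f0 := h.abs_le_mul_rpow hβ le_rfl (h1.trans h2) le_rfl
    rw [abs_mul]
    calc _ ≤ (W * (η - ξ) ^ β * (η - ξ) ^ β) * ((η - s) ^ (-δ) * ((s - ξ) / (η - ξ)) ^ β) := by
          gcongr
      _ = W * (η - ξ) ^ β * ((s - ξ) ^ β * (η - s) ^ (-δ)) := by
          rw [Real.div_rpow hsξ.le hL.le]; field_simp
      _ ≤ _ := by gcongr; linarith
  rw [e]
  calc _ ≤ _ := abs_sub _ _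
    _ ≤ _ := add_le_add e1 e3
    _ = _ := by ring

/-- The integral terms in the increment of the inner Weyl derivative. -/
theorem abs_integral_sub_le {s : ℝ} (hδ : 0 < δ) (hδβ : δ < β) (hβ1 : β ≤ 1) (h1 : ξ < s)
    (h2 : s < η) :
    |(∫ u in ξ..η, (ψ ξ η - ψ ξ u) / (η - u) ^ (δ + 1)) -
        ∫ u in s..η, (ψ s η - ψ s u) / (η - u) ^ (δ + 1)| ≤
      (betaConst 1 β + betaConst 1 (β - δ)) *
        ((W + X * Y) * (η - ξ) ^ β * ((s - ξ) ^ β * (η - s) ^ (-δ))) := by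
  have hW := h.nonneg
  have hXY := mul_nonneg h.nonneg_left h.nonneg_right
  have hL : 0 < η - ξ := by linarith
  have hs : 0 < η - s := sub_pos.2 h2
  have hsξ : 0 < s - ξ := sub_pos.2 h1
  have i1 := h.intervalIntegrable_quotient hβ hδβ (by linarith) le_rfl (h1.trans h2)
  have i2 := h.intervalIntegrable_quotient hβ hδβ (by linarith) h1.le h2
  have j1 : IntervalIntegrable (fun u => (ψ ξ η - ψ ξ u) / (η - u) ^ (δ + 1)) volume ξ s :=
    i1.mono_set (by rw [uIcc_of_le h1.le, uIcc_of_le (h1.trans h2).le]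
                    exact Icc_subset_Icc_right h2.le)
  have j2 : IntervalIntegrable (fun u => (ψ ξ η - ψ ξ u) / (η - u) ^ (δ + 1)) volume s η :=
    i1.mono_set (by rw [uIcc_of_le h2.le, uIcc_of_le (h1.trans h2).le]
                    exact Icc_subset_Icc_left h1.le)
  -- On `[ξ,s]` only the first integrand is present and is estimated alone; on `[s,η]` the
  -- difference of the integrands is a double increment of `ψ`.
  rw [← intervalIntegral.integral_add_adjacent_intervals j1 j2, add_sub_assoc,
    ← intervalIntegral.integral_sub j2 i2, add_mul]
  refine (abs_add_le _ _).trans (add_le_add ?_ ?_)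
  · rw [← Real.norm_eq_abs]
    refine (norm_integral_le_betaConst (p := 1) (q := β)
      (M := (W + X * Y) * (η - ξ) ^ β * (η - s) ^ (-δ)) h1 one_pos le_rfl (by linarith) hβ1
      (by positivity) fun u hu => ?_).trans_eq ?_
    · have hηu : 0 < η - u := by linarith [hu.2]
      have hsu : 0 < s - u := sub_pos.2 hu.2
      rw [Real.norm_eq_abs, sub_self, Real.rpow_zero, one_mul]
      refine (h.abs_quotient_le hβ le_rfl hu.1.le (hu.2.trans h2)).trans ?_
      rw [show β - δ - 1 = -δ + (β - 1) by ring, Real.rpow_add hηu, mul_assoc _ ((η - s) ^ (-δ))]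
      have f1 : (η - u) ^ (-δ) ≤ (η - s) ^ (-δ) :=
        Real.rpow_le_rpow_of_nonpos hs (by linarith) (by linarith)
      have f2 : (η - u) ^ (β - 1) ≤ (s - u) ^ (β - 1) :=
        Real.rpow_le_rpow_of_nonpos hsu (by linarith) (by linarith)
      gcongr
    · rw [show 1 + β - 1 = β by ring]; ring
  · rw [← Real.norm_eq_abs]
    refine (norm_integral_le_betaConst (p := 1) (q := β - δ)
      (M := X * Y * (s - ξ) ^ β) h2 one_pos le_rfl (by linarith) (by linarith)
      (by positivity) fun u hu => ?_).trans ?_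
    · have hηu : 0 < η - u := sub_pos.2 hu.2
      -- In the double increment the values of `ψ` cancel and a product of path increments remains,
      -- small in both variables at once.
      have e : ψ ξ η - ψ ξ u - (ψ s η - ψ s u) = (x s - x ξ) * (y η - y u) := by
        rw [← h.mul ξ u η le_rfl (h1.le.trans hu.1.le) hu.2.le le_rfl,
          ← h.mul s u η h1.le hu.1.le hu.2.le le_rfl]; ring
      rw [← sub_div, e, Real.norm_eq_abs, sub_self, Real.rpow_zero, one_mul, abs_div,
        abs_of_nonneg (show 0 ≤ (η - u) ^ (δ + 1) by positivity), div_le_iff₀ (by positivity),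
        mul_assoc _ _ ((η - u) ^ (δ + 1)), ← Real.rpow_add hηu,
        show β - δ - 1 + (δ + 1) = β by ring, mul_assoc _ _ ((η - u) ^ β)]
      exact h.abs_sub_mul_sub_le le_rfl h1.le h2.le (h1.le.trans hu.1.le) hu.2.le le_rfl
    · have f1 : (η - s) ^ (1 + (β - δ) - 1) ≤ (η - ξ) ^ β * (η - s) ^ (-δ) := by
        rw [show 1 + (β - δ) - 1 = β + -δ by ring, Real.rpow_add hs]
        have : (η - s) ^ β ≤ (η - ξ) ^ β := Real.rpow_le_rpow hs.le (by linarith) hβ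
        gcongr
      have f2 := betaConst_nonneg one_pos (sub_pos.2 hδβ)
      calc _ ≤ (W + X * Y) * (s - ξ) ^ β *
            (betaConst 1 (β - δ) * ((η - ξ) ^ β * (η - s) ^ (-δ))) := by gcongr; linarith
        _ = _ := by ring

end MultiplicativeBound

/-- Put `δ = 1-γ < β`. The inner derivative has size `(η-ξ)^β (η-ξ)^(β-δ)`, and its increment
between `ξ` and `s` has size `(η-ξ)^β (s-ξ)^β (η-s)^(-δ)`. The outer derivative of order `δ`
therefore costs one more `δ` and leaves the exponent `2(β-δ)`. -/
theorem exists_norm_gammaOp_le {γ : ℝ} (hγ : γ < 1) (hγβ : 1 - β < γ) (hβ1 : β ≤ 1) :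
    ∃ C : ℝ, 0 ≤ C ∧ ∀ (ξ η X Y W : ℝ) (x y : ℝ → ℝ) (ψ : ℝ → ℝ → ℝ), ξ < η →
      MultiplicativeBound β ξ η X Y W x y ψ →
      ‖gammaOp γ ψ ξ η‖ ≤ C * (W + X * Y) * (η - ξ) ^ (2 * (β + γ - 1)) := by
  set δ := 1 - γ with hδ'
  have hδ : 0 < δ := by linarith
  have hδβ : δ < β := by linarith
  have hδ1 : δ < 1 := by linarith
  have hβ : 0 ≤ β := by linarith
  have hG := inv_Gamma_nonneg hδ1
  have hB1 := betaConst_nonneg (p := 1) (q := β) one_pos (by linarith)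
  have hB2 := betaConst_nonneg (p := 1) (q := β - δ) one_pos (by linarith)
  have hW1 := weylConst_nonneg (p := 1) (q := β - δ) hδ hδ1 one_pos (by linarith)
  have hW2 := weylConst_nonneg (p := β - δ) (q := 1 - δ) hδ hδ1 (by linarith) (by linarith)
  set G := 1 / Real.Gamma (1 - δ)
  set C₁ := weylConst δ 1 (β - δ) + G * (2 + δ * (betaConst 1 β + betaConst 1 (β - δ))) with hC₁
  have hC₁0 : 0 ≤ C₁ := by positivity
  refine ⟨weylConst δ (β - δ) (1 - δ) * C₁, by positivity,
    fun ξ η X Y W x y ψ hξη h => ?_⟩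
  have hW := h.nonneg
  have hXY := mul_nonneg h.nonneg_left h.nonneg_right
  have hL : 0 < η - ξ := by linarith
  unfold gammaOp
  rw [← hδ']
  -- The exponent `q = 1-δ` records the singularity `(η-s)^(-δ)` of the inner derivative as its base
  -- point `s` approaches `η`.
  refine (norm_weylRight_le (p := β - δ) (q := 1 - δ) (M := C₁ * ((W + X * Y) * (η - ξ) ^ β))
    hδ hδ1 hξη (by linarith) (by linarith) (by linarith) (by linarith) (by positivity) ?_
    fun s hs => ?_).trans_eq ?_
  · refine (norm_weylLeft_le (p := β - δ) (q := 1) (M := (W + X * Y) * (η - ξ) ^ β)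
      hδ hδ1 hξη (by linarith) (by linarith) one_pos le_rfl (by positivity) ?_
      fun u hu => ?_).trans ?_
    · rw [Complex.norm_real, Real.norm_eq_abs, show δ + (β - δ) + 1 - 1 = β by ring]
      refine (h.abs_le_mul_rpow hβ le_rfl hξη le_rfl).trans ?_
      gcongr; linarith
    · rw [← Complex.ofReal_sub, Complex.norm_real, Real.norm_eq_abs, sub_self, Real.rpow_zero,
        one_mul, show δ + (β - δ) = β by ring]
      exact h.abs_sub_right_le hβ le_rfl hu.1.le hu.2
    · rw [show β - δ + 1 - 1 = β - δ by ring, show δ + (β - δ) + (1 - δ) - 1 = β - δ by ring]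
      have : weylConst δ 1 (β - δ) ≤ C₁ := le_add_of_nonneg_right (by positivity)
      gcongr
  · have hs1 : 0 < s - ξ := sub_pos.2 hs.1
    have hs2 : 0 < η - s := sub_pos.2 hs.2
    rw [weylLeft_ofReal, weylLeft_ofReal, ← Complex.ofReal_sub, Complex.norm_real,
      Real.norm_eq_abs, ← mul_sub, abs_mul, abs_of_nonneg hG]
    have e1 := h.abs_boundary_sub_le hβ hδ hδ1 hβ1 hs.1 hs.2
    have e2 := h.abs_integral_sub_le hβ hδ hδβ hβ1 hs.1 hs.2
    rw [show δ + (β - δ) = β by ring, show 1 - δ - 1 = -δ by ring]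
    set N := (W + X * Y) * (η - ξ) ^ β * ((s - ξ) ^ β * (η - s) ^ (-δ)) with hN
    have hN0 : 0 ≤ N := by positivity
    generalize (∫ u in ξ..η, (ψ ξ η - ψ ξ u) / (η - u) ^ (δ + 1)) = I₁ at e2 ⊢
    generalize (∫ u in s..η, (ψ s η - ψ s u) / (η - u) ^ (δ + 1)) = I₂ at e2 ⊢
    generalize ψ ξ η / (η - ξ) ^ δ = A₁ at e1 ⊢
    generalize ψ s η / (η - s) ^ δ = A₂ at e1 ⊢
    calc G * |A₁ + δ * I₁ - (A₂ + δ * I₂)|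
        ≤ G * (2 * N + δ * ((betaConst 1 β + betaConst 1 (β - δ)) * N)) := by
          refine mul_le_mul_of_nonneg_left ?_ hG
          rw [show A₁ + δ * I₁ - (A₂ + δ * I₂) = (A₁ - A₂) + δ * (I₁ - I₂) by ring]
          refine (abs_add_le _ _).trans (add_le_add e1 ?_)
          rw [abs_mul, abs_of_pos hδ]
          exact mul_le_mul_of_nonneg_left e2 hδ.le
      _ = G * (2 + δ * (betaConst 1 β + betaConst 1 (β - δ))) * N := by ring
      _ ≤ C₁ * N := mul_le_mul_of_nonneg_right (le_add_of_nonneg_left hW1) hN0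
      _ = _ := by rw [hN]; ring
  · have : (η - ξ) ^ (2 * (β + γ - 1)) = (η - ξ) ^ β * (η - ξ) ^ (β - δ + (1 - δ) - 1) := by
      rw [← Real.rpow_add hL]; congr 1; rw [hδ']; ring
    rw [this]; ring

end GammaOp

/-! ### The two factors of the single integral -/

section FirstIntegrand

variable {α β : ℝ}

/-- The product of increments of `x` and `z` has order `2β > α`, so the integral converges at `θ =
r`. In the boundary term only `x` is small near `a`, which accounts for the factor `(r-a)^(β-α)`;
the increment of `z` up to `c` enters through `N`. -/
theorem exists_norm_bigLambda_le (hα : 0 < α) (hα1 : α < 1) (hαβ : α < 2 * β) (hβ : β ≤ 1 / 2) :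
    ∃ C : ℝ, 0 ≤ C ∧ ∀ (a r c X Z N : ℝ) (x z : ℝ → ℝ), a < r → 0 ≤ X → 0 ≤ Z → 0 ≤ N →
      (∀ s, a ≤ s → s ≤ r → |x r - x s| ≤ X * (r - s) ^ β) →
      (∀ s, a ≤ s → s ≤ r → |z r - z s| ≤ Z * (r - s) ^ β) →
      |z c - z r| ≤ N →
      ‖bigLambda α x z a r c‖ ≤ C * (X * (N + Z * (r - a) ^ β)) * (r - a) ^ (β - α) := by
  have hB := betaConst_nonneg (p := 1) (q := 2 * β - α) one_pos (by linarith)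
  have hG := inv_Gamma_nonneg hα1
  refine ⟨1 / Real.Gamma (1 - α) * (1 + α * betaConst 1 (2 * β - α)), by positivity,
    fun a r c X Z N x z har hX hZ hN hx hz hzc => ?_⟩
  have hL : 0 < r - a := sub_pos.2 har
  unfold bigLambda
  rw [mul_assoc, norm_mul, norm_negOnePow, one_mul, Complex.ofReal_add, Complex.ofReal_mul]
  have hP : 0 ≤ (r - a) ^ β := by positivity
  refine norm_weyl_aux hα hG ?_ ?_
  · rw [Complex.norm_real, Real.norm_eq_abs, abs_div, abs_mul,
      abs_of_nonneg (show 0 ≤ (r - a) ^ α by positivity), div_le_iff₀ (by positivity),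
      mul_assoc _ _ ((r - a) ^ α), ← Real.rpow_add hL, sub_add_cancel]
    calc _ ≤ (X * (r - a) ^ β) * N := by gcongr; exact hx a le_rfl har.le
      _ ≤ (X * (r - a) ^ β) * (N + Z * (r - a) ^ β) := by
          gcongr; exact le_add_of_nonneg_right (by positivity)
      _ = _ := by ring
  · rw [Complex.norm_real]
    refine (norm_integral_le_betaConst (p := 1) (q := 2 * β - α) (M := Z * X) har one_pos le_rfl
      (by linarith) (by linarith) (by positivity) fun s hs => ?_).trans ?_
    · have hs' : 0 < r - s := sub_pos.2 hs.2
      rw [Real.norm_eq_abs, abs_div, abs_mul,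
        abs_of_nonneg (show 0 ≤ (r - s) ^ (α + 1) by positivity), div_le_iff₀ (by positivity),
        sub_self, Real.rpow_zero, one_mul, mul_assoc _ _ ((r - s) ^ (α + 1)),
        ← Real.rpow_add hs', show 2 * β - α - 1 + (α + 1) = β + β by ring, Real.rpow_add hs',
        abs_sub_comm (x s)]
      calc _ ≤ (Z * (r - s) ^ β) * (X * (r - s) ^ β) :=
            mul_le_mul (hz s hs.1.le hs.2.le) (hx s hs.1.le hs.2.le) (abs_nonneg _) (by positivity)
        _ = _ := by ring
    · rw [show 1 + (2 * β - α) - 1 = β + (β - α) by ring, Real.rpow_add hL]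
      have h1 : 0 ≤ X * N * (betaConst 1 (2 * β - α) * (r - a) ^ (β - α)) := by positivity
      linarith

theorem norm_weylRight_path_le (hα1 : α < 1) (hα : 0 < α) (hαβ : 1 - β < α) (hβ : β ≤ 1)
    {r b Y : ℝ} {y : ℝ → ℝ} (hrb : r < b) (hY : 0 ≤ Y)
    (hy : ∀ s t, r ≤ s → s ≤ t → t ≤ b → |y t - y s| ≤ Y * (t - s) ^ β) :
    ‖weylRight (1 - α) b (fun s => ((y s - y b : ℝ) : ℂ)) r‖ ≤
      weylConst (1 - α) (α + β - 1) 1 * Y * (b - r) ^ (α + β - 1) := by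
  have := norm_weylRight_le (δ := 1 - α) (b := b) (t := r) (p := α + β - 1) (q := 1) (M := Y)
    (f := fun s => ((y s - y b : ℝ) : ℂ)) (by linarith) (by linarith) hrb (by linarith)
    (by linarith) one_pos le_rfl hY ?_ fun s hs => ?_
  · rwa [show α + β - 1 + 1 - 1 = α + β - 1 by ring] at this
  · rw [Complex.norm_real, Real.norm_eq_abs, abs_sub_comm,
      show 1 - α + (α + β - 1) + 1 - 1 = β by ring]
    exact hy r b le_rfl hrb.le le_rfl
  · rw [← Complex.ofReal_sub, Complex.norm_real, Real.norm_eq_abs, sub_sub_sub_cancel_right,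
      abs_sub_comm, sub_self, Real.rpow_zero, mul_one, show 1 - α + (α + β - 1) = β by ring]
    exact hy r s le_rfl hs.1.le hs.2.le

end FirstIntegrand

/-! ### Hölder norms as suprema -/

section Norms

variable {β a b T : ℝ} {x : ℝ → ℝ} {ψ : ℝ → ℝ → ℝ}

theorem holderNorm_nonneg (β a b : ℝ) (x : ℝ → ℝ) : 0 ≤ holderNorm β a b x := by
  refine Real.sSup_nonneg ?_
  rintro v ⟨θ, r, -, h, -, rfl⟩
  have : 0 ≤ r - θ := by linarith
  positivity

theorem holderNorm₂_nonneg (β a b : ℝ) (ψ : ℝ → ℝ → ℝ) : 0 ≤ holderNorm₂ β a b ψ := by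
  refine Real.sSup_nonneg ?_
  rintro v ⟨θ, r, -, h, -, rfl⟩
  have : 0 ≤ r - θ := by linarith
  positivity

/-- The real supremum of an unbounded set is `0` by convention, so boundedness has to be known
before the norm controls any increment. -/
theorem bddAbove_holderQuotients (hβ : 0 < β)
    (hx : ∃ C : ℝ≥0, HolderOnWith C (Real.toNNReal β) x (Icc 0 T)) (ha : 0 ≤ a) (hb : b ≤ T) :
    BddAbove {v : ℝ | ∃ θ r : ℝ, a ≤ θ ∧ θ < r ∧ r ≤ b ∧ v = |x r - x θ| / (r - θ) ^ β} := by
  obtain ⟨C, hC⟩ := hx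
  refine ⟨C, ?_⟩
  rintro v ⟨θ, r, h1, h2, h3, rfl⟩
  have h : 0 < r - θ := sub_pos.2 h2
  have := hC.dist_le (x := r) (y := θ) ⟨by linarith, by linarith⟩ ⟨by linarith, by linarith⟩
  rw [Real.dist_eq, Real.dist_eq, abs_of_pos h, Real.coe_toNNReal _ hβ.le] at this
  exact (div_le_iff₀ (by positivity)).2 this

theorem bddAbove_holderQuotients₂
    (hψ : ∃ C : ℝ, ∀ s t : ℝ, 0 ≤ s → s ≤ t → t ≤ T → |ψ s t| ≤ C * (t - s) ^ (2 * β))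
    (ha : 0 ≤ a) (hb : b ≤ T) :
    BddAbove {v : ℝ | ∃ θ r : ℝ, a ≤ θ ∧ θ < r ∧ r ≤ b ∧ v = |ψ θ r| / (r - θ) ^ (2 * β)} := by
  obtain ⟨C, hC⟩ := hψ
  refine ⟨C, ?_⟩
  rintro v ⟨θ, r, h1, h2, h3, rfl⟩
  have h : 0 < r - θ := sub_pos.2 h2
  exact (div_le_iff₀ (by positivity)).2 (hC θ r (by linarith) h2.le (by linarith))

theorem abs_sub_le_holderNorm (hβ : 0 < β)
    (hx : ∃ C : ℝ≥0, HolderOnWith C (Real.toNNReal β) x (Icc 0 T)) (ha : 0 ≤ a) (hb : b ≤ T)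
    {s t : ℝ} (h1 : a ≤ s) (h2 : s ≤ t) (h3 : t ≤ b) :
    |x t - x s| ≤ holderNorm β a b x * (t - s) ^ β := by
  rcases h2.eq_or_lt with rfl | h2
  · simp [Real.zero_rpow hβ.ne']
  have h : 0 < t - s := sub_pos.2 h2
  rw [← div_le_iff₀ (by positivity)]
  exact le_csSup (bddAbove_holderQuotients hβ hx ha hb) ⟨s, t, h1, h2, h3, rfl⟩

theorem abs_le_holderNorm₂ (hβ : 0 < β)
    (hψ : ∃ C : ℝ, ∀ s t : ℝ, 0 ≤ s → s ≤ t → t ≤ T → |ψ s t| ≤ C * (t - s) ^ (2 * β))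
    (ha : 0 ≤ a) (hb : b ≤ T) {s t : ℝ} (h1 : a ≤ s) (h2 : s ≤ t) (h3 : t ≤ b) :
    |ψ s t| ≤ holderNorm₂ β a b ψ * (t - s) ^ (2 * β) := by
  rcases h2.eq_or_lt with rfl | h2
  -- The diagonal is absent from the supremum; there the hypothesis itself forces `ψ s s = 0`, since
  -- `0 ^ (2 * β) = 0`.
  · obtain ⟨C, hC⟩ := hψ
    have := hC s s (by linarith) le_rfl (by linarith)
    have h2 : 2 * β ≠ 0 := by positivity
    rw [sub_self, Real.zero_rpow h2, mul_zero] at this ⊢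
    exact this
  have h : 0 < t - s := sub_pos.2 h2
  rw [← div_le_iff₀ (by positivity)]
  exact le_csSup (bddAbove_holderQuotients₂ hψ ha hb) ⟨s, t, h1, h2, h3, rfl⟩

theorem holderNorm_mono (hβ : 0 < β)
    (hx : ∃ C : ℝ≥0, HolderOnWith C (Real.toNNReal β) x (Icc 0 T)) (ha : 0 ≤ a) (hb : b ≤ T)
    {a' b' : ℝ} (ha' : a ≤ a') (hb' : b' ≤ b) : holderNorm β a' b' x ≤ holderNorm β a b x := by
  refine Real.sSup_le ?_ (holderNorm_nonneg β a b x)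
  rintro v ⟨θ, r, h1, h2, h3, rfl⟩
  exact le_csSup (bddAbove_holderQuotients hβ hx ha hb)
    ⟨θ, r, ha'.trans h1, h2, h3.trans hb', rfl⟩

theorem holderNorm₂_mono
    (hψ : ∃ C : ℝ, ∀ s t : ℝ, 0 ≤ s → s ≤ t → t ≤ T → |ψ s t| ≤ C * (t - s) ^ (2 * β))
    (ha : 0 ≤ a) (hb : b ≤ T) {a' b' : ℝ} (ha' : a ≤ a') (hb' : b' ≤ b) :
    holderNorm₂ β a' b' ψ ≤ holderNorm₂ β a b ψ := by
  refine Real.sSup_le ?_ (holderNorm₂_nonneg β a b ψ)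
  rintro v ⟨θ, r, h1, h2, h3, rfl⟩
  exact le_csSup (bddAbove_holderQuotients₂ hψ ha hb)
    ⟨θ, r, ha'.trans h1, h2, h3.trans hb', rfl⟩

theorem IsHolderMultiplicative.multiplicativeBound {y : ℝ → ℝ} (hβ : 0 < β)
    (h : IsHolderMultiplicative β T x y ψ) (ha : 0 ≤ a) (hb : b ≤ T) :
    MultiplicativeBound β a b (holderNorm β a b x) (holderNorm β a b y) (holderNorm₂ β a b ψ)
      x y ψ where
  nonneg_left := holderNorm_nonneg _ _ _ _
  nonneg_right := holderNorm_nonneg _ _ _ _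
  nonneg := holderNorm₂_nonneg _ _ _ _
  left := fun _ _ h1 h2 h3 => abs_sub_le_holderNorm hβ h.holder_left ha hb h1 h2 h3
  right := fun _ _ h1 h2 h3 => abs_sub_le_holderNorm hβ h.holder_right ha hb h1 h2 h3
  bound := fun _ _ h1 h2 h3 => abs_le_holderNorm₂ hβ h.bound ha hb h1 h2 h3
  mul := fun s u t h1 h2 h3 h4 => h.multiplicative s u t (ha.trans h1) h2 h3 (h4.trans hb)
  meas := fun s h1 h2 => by
    refine ContinuousOn.aestronglyMeasurable ?_ measurableSet_Ioc
    exact h.continuousOn.comp (f := fun t => (s, t)) (by fun_prop)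
      fun t ht => ⟨ha.trans h1, ht.1.le, ht.2.trans hb⟩

end Norms

/-! ### Measurability of the two integrands -/

section Measurability

theorem weylRight_congr {δ b t : ℝ} {f g : ℝ → ℂ} (htb : t ≤ b) (h : EqOn f g (Icc t b)) :
    weylRight δ b f t = weylRight δ b g t := by
  unfold weylRight
  have ht : f t = g t := h ⟨le_rfl, htb⟩
  rw [intervalIntegral.integral_congr (g := fun s => (g t - g s) / (((s - t) ^ (δ + 1) : ℝ) : ℂ)),
    ht]
  intro s hs
  rw [uIcc_of_le htb] at hs
  simp only [ht, h hs]

theorem weylLeft_congr {δ a t : ℝ} {f g : ℝ → ℂ} (hat : a ≤ t) (h : EqOn f g (Icc a t)) :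
    weylLeft δ a f t = weylLeft δ a g t := by
  unfold weylLeft
  have ht : f t = g t := h ⟨hat, le_rfl⟩
  rw [intervalIntegral.integral_congr (g := fun s => (g t - g s) / (((t - s) ^ (δ + 1) : ℝ) : ℂ)),
    ht]
  intro s hs
  rw [uIcc_of_le hat] at hs
  simp only [ht, h hs]

theorem gammaOp_congr {γ ξ η : ℝ} {ψ φ : ℝ → ℝ → ℝ} (hξη : ξ ≤ η)
    (h : ∀ s t, ξ ≤ s → s ≤ t → t ≤ η → ψ s t = φ s t) : gammaOp γ ψ ξ η = gammaOp γ φ ξ η := by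
  refine weylRight_congr hξη fun s hs => weylLeft_congr hs.2 fun t ht => ?_
  simp only [h s t hs.1 ht.1 ht.2]

theorem bigLambda_congr {α a r c : ℝ} {x z x' z' : ℝ → ℝ} (har : a ≤ r)
    (hx : EqOn x x' (Icc a r)) (hz : EqOn z z' (Icc a r)) (hc : z c = z' c) :
    bigLambda α x z a r c = bigLambda α x' z' a r c := by
  have ha : a ∈ Icc a r := ⟨le_rfl, har⟩
  have hr : r ∈ Icc a r := ⟨har, le_rfl⟩
  unfold bigLambda
  rw [intervalIntegral.integral_congr
    (g := fun θ => (z' r - z' θ) * (x' θ - x' r) / (r - θ) ^ (α + 1)), hx ha, hx hr, hz hr, hc]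
  intro s hs
  rw [uIcc_of_le har] at hs
  simp only [hx hs, hz hs, hx hr, hz hr]

theorem measurableSet_simplex (a b : ℝ) : MeasurableSet (simplex a b) := by
  have h1 : Measurable fun p : ℝ × ℝ × ℝ => p.2.1 := by fun_prop
  have h2 : Measurable fun p : ℝ × ℝ × ℝ => p.2.2 := by fun_prop
  exact (measurableSet_lt measurable_const measurable_fst).inter
    ((measurableSet_lt measurable_fst h1).inter ((measurableSet_lt h1 h2).inter
      (measurableSet_lt h2 measurable_const)))

theorem exists_measurable_eqOn {X : Type*} [TopologicalSpace X] [MeasurableSpace X] [BorelSpace X]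
    {f : X → ℝ} {S : Set X} (hf : ContinuousOn f S) (hS : MeasurableSet S) :
    ∃ g : X → ℝ, Measurable g ∧ EqOn f g S := by
  classical
  exact ⟨S.piecewise f 0, hf.measurable_piecewise continuousOn_const hS,
    (S.piecewise_eqOn f 0).symm⟩

variable {β α ε T a b c : ℝ} {x y z : ℝ → ℝ} {xy yz : ℝ → ℝ → ℝ}

/-- The data are controlled on `[0,T]` only. Replacing them by globally measurable functions with
the same values there leaves the integrands unchanged on their domains, by the congruence lemmas
above. -/
theorem exists_measurable_eqOn_of_holder (hβ : 0 < β)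
    (hx : ∃ C : ℝ≥0, HolderOnWith C (Real.toNNReal β) x (Icc 0 T)) :
    ∃ x' : ℝ → ℝ, Measurable x' ∧ EqOn x x' (Icc 0 T) :=
  let ⟨_, hC⟩ := hx
  exists_measurable_eqOn (hC.continuousOn (Real.toNNReal_pos.2 hβ)) measurableSet_Icc

theorem IsHolderMultiplicative.exists_measurable (h : IsHolderMultiplicative β T x y xy) :
    ∃ ψ : ℝ → ℝ → ℝ, Measurable (Function.uncurry ψ) ∧
      ∀ s t, 0 ≤ s → s ≤ t → t ≤ T → xy s t = ψ s t := by
  have hS : MeasurableSet {p : ℝ × ℝ | 0 ≤ p.1 ∧ p.1 ≤ p.2 ∧ p.2 ≤ T} :=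
    (measurableSet_le measurable_const measurable_fst).inter
      ((measurableSet_le measurable_fst measurable_snd).inter
        (measurableSet_le measurable_snd measurable_const))
  obtain ⟨g, hg, hgeq⟩ := exists_measurable_eqOn h.continuousOn hS
  exact ⟨fun s t => g (s, t), hg, fun s t h1 h2 h3 => hgeq (x := (s, t)) ⟨h1, h2, h3⟩⟩

theorem aestronglyMeasurable_firstIntegrand (hβ : 0 < β)
    (hxy : IsHolderMultiplicative β T x y xy) (hyz : IsHolderMultiplicative β T y z yz)
    (ha : 0 ≤ a) (hab : a ≤ b) (hbc : b ≤ c) (hc : c ≤ T) :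
    AEStronglyMeasurable (firstIntegrand α x y z a b c) (volume.restrict (Ioc a b)) := by
  obtain ⟨x', hx', ex⟩ := exists_measurable_eqOn_of_holder hβ hxy.holder_left
  obtain ⟨y', hy', ey⟩ := exists_measurable_eqOn_of_holder hβ hxy.holder_right
  obtain ⟨z', hz', ez⟩ := exists_measurable_eqOn_of_holder hβ hyz.holder_right
  have hm : Measurable fun r => bigLambda α x' z' a r c *
      weylRight (1 - α) b (fun s => ((y' s - y' b : ℝ) : ℂ)) r := by
    refine (measurable_bigLambda α hx' hz' a c).mul (measurable_weylRight _ measurable_const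
      measurable_id ?_)
    unfold Function.uncurry
    fun_prop
  refine hm.aestronglyMeasurable.congr ?_
  refine (ae_restrict_iff' measurableSet_Ioc).2 (Filter.Eventually.of_forall fun r hr => ?_)
  have hs1 : Icc a r ⊆ Icc 0 T := Icc_subset_Icc ha (by linarith [hr.2])
  have hs2 : Icc r b ⊆ Icc 0 T := Icc_subset_Icc (by linarith [hr.1]) (by linarith)
  unfold firstIntegrand
  rw [bigLambda_congr hr.1.le (ex.mono hs1) (ez.mono hs1) (ez ⟨by linarith, hc⟩),
    weylRight_congr (g := fun s => ((y' s - y' b : ℝ) : ℂ)) hr.2 fun s hs => ?_]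
  simp only [ey (hs2 hs), ey (hs2 ⟨hr.2, le_rfl⟩)]

theorem aestronglyMeasurable_secondIntegrand (hβ : 0 < β)
    (hxy : IsHolderMultiplicative β T x y xy) (hyz : IsHolderMultiplicative β T y z yz)
    (ha : 0 ≤ a) (hbc : b ≤ c) (hc : c ≤ T) :
    AEStronglyMeasurable (secondIntegrand α ε x z xy yz a b c)
      (volume.restrict (simplex a b)) := by
  obtain ⟨x', hx', ex⟩ := exists_measurable_eqOn_of_holder hβ hxy.holder_left
  obtain ⟨z', hz', ez⟩ := exists_measurable_eqOn_of_holder hβ hyz.holder_right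
  obtain ⟨ψ, hψ, eψ⟩ := hxy.exists_measurable
  obtain ⟨φ, hφ, eφ⟩ := hyz.exists_measurable
  have hm : Measurable (secondIntegrand α ε x' z' ψ φ a b c) := by
    have h1 := measurable_kernelK (P := ℝ × ℝ × ℝ) α ε (θ := fun p => p.1) (b := fun _ => b)
      (ξ := fun p => p.2.1) (η := fun p => p.2.2) (by fun_prop) (by fun_prop) (by fun_prop)
      (by fun_prop)
    have h2 := measurable_gammaOp (P := ℝ × ℝ × ℝ) (α - ε) hψ (ξ := fun p => p.2.1)
      (η := fun p => p.2.2) (by fun_prop) (by fun_prop)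
    have h3 := measurable_gammaOp (P := ℝ × ℝ × ℝ) (α - ε) hφ (ξ := fun p => p.2.1)
      (η := fun p => p.2.2) (by fun_prop) (by fun_prop)
    unfold secondIntegrand
    fun_prop
  refine hm.aestronglyMeasurable.congr ?_
  refine (ae_restrict_iff' (measurableSet_simplex a b)).2 (Filter.Eventually.of_forall ?_)
  rintro ⟨r, ξ, η⟩ ⟨h1, h2, h3, h4⟩
  simp only at h1 h2 h3 h4
  have g1 : gammaOp (α - ε) xy ξ η = gammaOp (α - ε) ψ ξ η :=
    gammaOp_congr h3.le fun s t i j k => eψ s t (by linarith) j (by linarith)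
  have g2 : gammaOp (α - ε) yz ξ η = gammaOp (α - ε) φ ξ η :=
    gammaOp_congr h3.le fun s t i j k => eφ s t (by linarith) j (by linarith)
  unfold secondIntegrand
  simp only
  rw [g1, g2, ez ⟨by linarith, hc⟩, ez (x := r) ⟨by linarith, by linarith⟩,
    ex (x := r) ⟨by linarith, by linarith⟩, ex (x := a) ⟨by linarith, by linarith⟩]

end Measurability

/-! ### Integration over the simplex -/

section SimplexIntegral

open scoped ENNReal

/-- Tonelli, integrating the last variable first: by translation invariance each inner integral is
independent of the outer variables. -/
theorem lintegral_mul_sub_mul_sub {f g h : ℝ → ℝ≥0∞} (hf : Measurable f) (hg : Measurable g)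
    (hh : Measurable h) (a : ℝ) :
    ∫⁻ p : ℝ × ℝ × ℝ, f (p.1 - a) * (g (p.2.1 - p.1) * h (p.2.2 - p.2.1)) =
      (∫⁻ t, f t) * ((∫⁻ t, g t) * ∫⁻ t, h t) := by
  rw [Measure.volume_eq_prod, lintegral_prod _ (by fun_prop)]
  have e : ∀ r : ℝ, ∫⁻ q : ℝ × ℝ, f (r - a) * (g (q.1 - r) * h (q.2 - q.1)) =
      f (r - a) * ((∫⁻ t, g t) * ∫⁻ t, h t) := fun r => by
    rw [lintegral_const_mul _ (by fun_prop), Measure.volume_eq_prod,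
      lintegral_prod _ (by fun_prop)]
    congr 1
    have e' : ∀ s : ℝ, ∫⁻ t : ℝ, g (s - r) * h (t - s) = g (s - r) * ∫⁻ t, h t := fun s => by
      rw [lintegral_const_mul _ (by fun_prop), lintegral_sub_right_eq_self]
    simp only [e']
    rw [lintegral_mul_const _ (by fun_prop), lintegral_sub_right_eq_self]
  simp only [e]
  rw [lintegral_mul_const _ (by fun_prop), lintegral_sub_right_eq_self]

/-- The power `t ^ (e - 1)` cut off outside `(0, L)`. -/
noncomputable def cutPower (L e : ℝ) : ℝ → ℝ≥0∞ :=
  (Ioo 0 L).indicator fun t => ENNReal.ofReal (t ^ (e - 1))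

theorem measurable_cutPower (L e : ℝ) : Measurable (cutPower L e) :=
  Measurable.indicator (by fun_prop) measurableSet_Ioo

theorem lintegral_cutPower {L e : ℝ} (hL : 0 ≤ L) (he : 0 < e) :
    ∫⁻ t, cutPower L e t = ENNReal.ofReal (L ^ e / e) := by
  have h := integral_sub_rpow (a := 0) (b := L) he
  have hi := intervalIntegrable_sub_rpow (a := 0) (b := L) he
  simp only [sub_zero] at h hi
  rw [← h, intervalIntegral.integral_of_le hL, integral_Ioc_eq_integral_Ioo]
  rw [intervalIntegrable_iff_integrableOn_Ioo_of_le hL] at hi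
  rw [ofReal_integral_eq_lintegral_ofReal hi]
  · rw [cutPower, lintegral_indicator measurableSet_Ioo]
  · exact (ae_restrict_iff' measurableSet_Ioo).2 (Filter.Eventually.of_forall fun t ht =>
      Real.rpow_nonneg ht.1.le _)

/-- On the simplex each of the three gaps lies in `(0, b-a)`, so the integral is at most that over a
cube in the gap variables, where it factorises. -/
theorem integrableOn_simplex_of_le {a b e₁ e₂ e₃ M : ℝ} {F : ℝ × ℝ × ℝ → ℂ} (hab : a < b)
    (h₁ : 0 < e₁) (h₂ : 0 < e₂) (h₃ : 0 < e₃) (hM : 0 ≤ M)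
    (hF : AEStronglyMeasurable F (volume.restrict (simplex a b)))
    (h : ∀ r ξ η, a < r → r < ξ → ξ < η → η < b → ‖F (r, ξ, η)‖ ≤
      M * ((r - a) ^ (e₁ - 1) * ((ξ - r) ^ (e₂ - 1) * (η - ξ) ^ (e₃ - 1)))) :
    IntegrableOn F (simplex a b) ∧
      ‖∫ p in simplex a b, F p‖ ≤ M * (b - a) ^ (e₁ + e₂ + e₃) / (e₁ * e₂ * e₃) := by
  have hL : 0 < b - a := sub_pos.2 hab
  have key : ∫⁻ p in simplex a b, ‖F p‖ₑ ≤
      ENNReal.ofReal (M * (b - a) ^ (e₁ + e₂ + e₃) / (e₁ * e₂ * e₃)) := by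
    calc ∫⁻ p in simplex a b, ‖F p‖ₑ
        ≤ ∫⁻ p in simplex a b, ENNReal.ofReal M * (cutPower (b - a) e₁ (p.1 - a) *
          (cutPower (b - a) e₂ (p.2.1 - p.1) * cutPower (b - a) e₃ (p.2.2 - p.2.1))) := by
          refine setLIntegral_mono' (measurableSet_simplex a b) ?_
          rintro ⟨r, ξ, η⟩ ⟨i1, i2, i3, i4⟩
          simp only at i1 i2 i3 i4
          have j1 : 0 < r - a := sub_pos.2 i1
          have j2 : 0 < ξ - r := sub_pos.2 i2
          have j3 : 0 < η - ξ := sub_pos.2 i3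
          simp only [cutPower]
          rw [indicator_of_mem (show r - a ∈ Ioo 0 (b - a) from ⟨j1, by linarith⟩),
            indicator_of_mem (show ξ - r ∈ Ioo 0 (b - a) from ⟨j2, by linarith⟩),
            indicator_of_mem (show η - ξ ∈ Ioo 0 (b - a) from ⟨j3, by linarith⟩),
            ← ENNReal.ofReal_mul (by positivity), ← ENNReal.ofReal_mul (by positivity),
            ← ENNReal.ofReal_mul hM, ← ofReal_norm]
          exact ENNReal.ofReal_le_ofReal (h r ξ η i1 i2 i3 i4)
      _ ≤ ∫⁻ p : ℝ × ℝ × ℝ, ENNReal.ofReal M * (cutPower (b - a) e₁ (p.1 - a) *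
          (cutPower (b - a) e₂ (p.2.1 - p.1) * cutPower (b - a) e₃ (p.2.2 - p.2.1))) :=
          setLIntegral_le_lintegral _ _
      _ = _ := by
          have m1 := measurable_cutPower (b - a) e₁
          have m2 := measurable_cutPower (b - a) e₂
          have m3 := measurable_cutPower (b - a) e₃
          rw [lintegral_const_mul _ (by fun_prop), lintegral_mul_sub_mul_sub m1 m2 m3,
            lintegral_cutPower hL.le h₁, lintegral_cutPower hL.le h₂, lintegral_cutPower hL.le h₃,
            ← ENNReal.ofReal_mul (by positivity), ← ENNReal.ofReal_mul (by positivity),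
            ← ENNReal.ofReal_mul hM, Real.rpow_add hL, Real.rpow_add hL]
          congr 1
          field_simp
  refine ⟨⟨hF, key.trans_lt ENNReal.ofReal_lt_top⟩, ?_⟩
  have := (enorm_integral_le_lintegral_enorm F).trans key
  rw [← ofReal_norm] at this
  exact (ENNReal.ofReal_le_ofReal_iff (by positivity)).1 this

end SimplexIntegral

/-! ### The two integrals and the triple product -/

section Estimates

variable {β α ε T : ℝ}

/-- The power `(b-r)^(α+β-1)` has positive exponent and is replaced by its maximum; integrating
`(r-a)^(β-α)` adds `β-α+1`, for a total of `2β`. -/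
theorem exists_firstIntegrand_bound (hβ₂ : β < 1 / 2) (hα₁ : 1 - β < α)
    (hα₂ : α < 2 * β) : ∃ C : ℝ, 0 ≤ C ∧
      ∀ (x y z : ℝ → ℝ) (xy yz : ℝ → ℝ → ℝ), IsHolderMultiplicative β T x y xy →
        IsHolderMultiplicative β T y z yz →
        ∀ a b c : ℝ, 0 ≤ a → a < b → b ≤ c → c ≤ T →
          IntervalIntegrable (firstIntegrand α x y z a b c) volume a b ∧
          ‖∫ r in a..b, firstIntegrand α x y z a b c r‖ ≤
            C * (holderNorm β a b x * holderNorm β a b y *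
              (holderNorm β a c z * (c - a) ^ β + holderNorm β a b z * (b - a) ^ β)) *
              (b - a) ^ (2 * β) := by
  have hβ : 0 < β := by linarith
  obtain ⟨C₁, hC₁, H₁⟩ := exists_norm_bigLambda_le (α := α) (β := β) (by linarith) (by linarith)
    hα₂ hβ₂.le
  have hW := weylConst_nonneg (δ := 1 - α) (p := α + β - 1) (q := 1) (by linarith) (by linarith)
    (by linarith) one_pos
  have hB := betaConst_nonneg (p := β - α + 1) (q := 1) (by linarith) one_pos
  refine ⟨C₁ * weylConst (1 - α) (α + β - 1) 1 * betaConst (β - α + 1) 1, by positivity,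
    fun x y z xy yz hxy hyz a b c ha hab hbc hc => ?_⟩
  have hL : 0 < b - a := sub_pos.2 hab
  have hbT : b ≤ T := hbc.trans hc
  have hX := holderNorm_nonneg β a b x
  have hY := holderNorm_nonneg β a b y
  have hZ := holderNorm_nonneg β a b z
  have hN : 0 ≤ holderNorm β a c z * (c - a) ^ β :=
    mul_nonneg (holderNorm_nonneg _ _ _ _) (Real.rpow_nonneg (by linarith) _)
  set N := holderNorm β a c z * (c - a) ^ β with hNdef
  set M := C₁ * (holderNorm β a b x * (N + holderNorm β a b z * (b - a) ^ β)) *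
    (weylConst (1 - α) (α + β - 1) 1 * holderNorm β a b y * (b - a) ^ (α + β - 1)) with hM
  have hM0 : 0 ≤ M := by positivity
  have hbound : ∀ r ∈ Ioo a b, ‖firstIntegrand α x y z a b c r‖ ≤
      M * ((r - a) ^ (β - α + 1 - 1) * (b - r) ^ ((1 : ℝ) - 1)) := by
    intro r hr
    have h1 : 0 < r - a := sub_pos.2 hr.1
    have h2 : 0 < b - r := sub_pos.2 hr.2
    rw [sub_self, Real.rpow_zero, mul_one, add_sub_cancel_right, firstIntegrand, norm_mul]
    have e1 := H₁ a r c (holderNorm β a b x) (holderNorm β a b z) N x z hr.1 hX hZ hN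
      (fun s i j => abs_sub_le_holderNorm hβ hxy.holder_left ha hbT i j hr.2.le)
      (fun s i j => abs_sub_le_holderNorm hβ hyz.holder_right ha hbT i j hr.2.le)
      ((abs_sub_le_holderNorm hβ hyz.holder_right ha hc hr.1.le (hr.2.le.trans hbc) le_rfl).trans
        (mul_le_mul_of_nonneg_left (Real.rpow_le_rpow (by linarith) (by linarith) hβ.le)
          (holderNorm_nonneg _ _ _ _)))
    have e2 := norm_weylRight_path_le (α := α) (β := β) (by linarith) (by linarith) hα₁
      (by linarith) hr.2 hY
      (fun s t i j k => abs_sub_le_holderNorm hβ hxy.holder_right ha hbT (hr.1.le.trans i) j k)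
    have f1 : (r - a) ^ β ≤ (b - a) ^ β := Real.rpow_le_rpow h1.le (by linarith) hβ.le
    have f2 : (b - r) ^ (α + β - 1) ≤ (b - a) ^ (α + β - 1) :=
      Real.rpow_le_rpow h2.le (by linarith) (by linarith)
    calc _ ≤ (C₁ * (holderNorm β a b x * (N + holderNorm β a b z * (b - a) ^ β)) *
          (r - a) ^ (β - α)) * (weylConst (1 - α) (α + β - 1) 1 * holderNorm β a b y *
            (b - a) ^ (α + β - 1)) := by
          refine mul_le_mul (e1.trans ?_) (e2.trans ?_) (norm_nonneg _) (by positivity)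
          · gcongr
          · gcongr
      _ = _ := by rw [hM]; ring
  refine ⟨intervalIntegrable_of_le_beta hab.le (by linarith) (by linarith) one_pos le_rfl hM0
    (aestronglyMeasurable_firstIntegrand hβ hxy hyz ha hab.le hbc hc) hbound, ?_⟩
  refine (norm_integral_le_betaConst hab (by linarith) (by linarith) one_pos le_rfl hM0
    hbound).trans_eq ?_
  have e : (b - a) ^ (2 * β) = (b - a) ^ (α + β - 1) * (b - a) ^ (β - α + 1 + 1 - 1) := by
    rw [← Real.rpow_add hL]; congr 1; ring
  rw [e, hM]; ring

theorem exists_secondIntegrand_bound (hβ₂ : β < 1 / 2)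
    (hα₂ : α < 2 * β) (hε₁ : 0 < ε) (hε₂ : ε < α + β - 1) : ∃ C : ℝ, 0 ≤ C ∧
      ∀ (x y z : ℝ → ℝ) (xy yz : ℝ → ℝ → ℝ), IsHolderMultiplicative β T x y xy →
        IsHolderMultiplicative β T y z yz →
        ∀ a b c : ℝ, 0 ≤ a → a < b → b ≤ c → c ≤ T →
          IntegrableOn (secondIntegrand α ε x z xy yz a b c) (simplex a b) volume ∧
          ‖∫ p in simplex a b, secondIntegrand α ε x z xy yz a b c p‖ ≤
            C * ((holderNorm₂ β a b xy + holderNorm β a b x * holderNorm β a b y) *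
                (holderNorm β a c z * (c - a) ^ β) +
              holderNorm β a b x * (b - a) ^ β *
                (holderNorm₂ β a b yz + holderNorm β a b y * holderNorm β a b z)) *
              (b - a) ^ (2 * β) := by
  have hβ : 0 < β := by linarith
  -- With this choice `Γ^(α-ε)` has exponent `2l`, so multiplication by `(η-ξ)^(-1-l)` from `K`
  -- gives `(η-ξ)^(l-1)`, integrable because `ε < α+β-1`.
  set l := α + β - 1 - ε with hl
  have hl0 : 0 < l := by linarith
  obtain ⟨C₁, hC₁, H₁⟩ := exists_norm_kernelK_le (α := α) (ε := ε) (l := l) (by linarith)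
    (by linarith) hε₁ (by linarith) hl0 (by linarith)
  obtain ⟨C₂, hC₂, H₂⟩ := exists_norm_gammaOp_le (β := β) (γ := α - ε) (by linarith) (by linarith)
    (by linarith)
  have hden : 0 < (2 - 2 * α) * ε * l := mul_pos (mul_pos (by linarith) hε₁) hl0
  refine ⟨C₁ * C₂ / ((2 - 2 * α) * ε * l), by positivity,
    fun x y z xy yz hxy hyz a b c ha hab hbc hc => ?_⟩
  have hL : 0 < b - a := sub_pos.2 hab
  have hbT : b ≤ T := hbc.trans hc
  have bxy := hxy.multiplicativeBound hβ ha hbT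
  have byz := hyz.multiplicativeBound hβ ha hbT
  have hX := bxy.nonneg_left
  have hWX : 0 ≤ holderNorm₂ β a b xy + holderNorm β a b x * holderNorm β a b y :=
    add_nonneg bxy.nonneg (mul_nonneg hX bxy.nonneg_right)
  have hWZ : 0 ≤ holderNorm₂ β a b yz + holderNorm β a b y * holderNorm β a b z :=
    add_nonneg byz.nonneg (mul_nonneg byz.nonneg_left byz.nonneg_right)
  set X := holderNorm β a b x with hXdef
  set A := holderNorm₂ β a b xy + X * holderNorm β a b y with hA
  set B := holderNorm₂ β a b yz + holderNorm β a b y * holderNorm β a b z with hB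
  have hN : 0 ≤ holderNorm β a c z * (c - a) ^ β :=
    mul_nonneg (holderNorm_nonneg _ _ _ _) (Real.rpow_nonneg (by linarith) _)
  set N := holderNorm β a c z * (c - a) ^ β with hNdef
  set Q := A * N + X * (b - a) ^ β * B with hQ
  have hQ0 : 0 ≤ Q := by positivity
  -- The exponents come from `(r-a)^(1-2α)`, `(ξ-r)^(ε-1)` and `(η-ξ)^(l-1)`; the factor
  -- `(b-a)^(l+ε)` bounds `(b-r)^l (b-η)^ε`. In total `2 - 2α + 2(l+ε) = 2β`.
  have main := integrableOn_simplex_of_le (e₁ := 2 - 2 * α) (e₂ := ε) (e₃ := l)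
    (M := C₁ * C₂ * Q * (b - a) ^ (l + ε)) hab (by linarith) hε₁ hl0 (by positivity)
    (aestronglyMeasurable_secondIntegrand (α := α) (ε := ε) (a := a) hβ hxy hyz ha hbc hc)
    fun r ξ η h1 h2 h3 h4 => ?_
  · refine ⟨main.1, main.2.trans_eq ?_⟩
    have e : (b - a) ^ (2 * β) = (b - a) ^ (l + ε) * (b - a) ^ (2 - 2 * α + ε + l) := by
      rw [← Real.rpow_add hL]; congr 1; rw [hl]; ring
    rw [e]; ring
  · have j1 : 0 < r - a := sub_pos.2 h1
    have j2 : 0 < ξ - r := sub_pos.2 h2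
    have j3 : 0 < η - ξ := sub_pos.2 h3
    have j4 : 0 < b - η := sub_pos.2 h4
    have j5 : 0 < b - r := by linarith
    have g1 := H₂ ξ η _ _ _ x y xy h3 (bxy.restrict (by linarith) h4.le)
    have g2 := H₂ ξ η _ _ _ y z yz h3 (byz.restrict (by linarith) h4.le)
    rw [show β + (α - ε) - 1 = l by rw [hl]; ring] at g1 g2
    rw [← hA] at g1
    rw [← hB] at g2
    have g3 : |z c - z r| ≤ N :=
      (abs_sub_le_holderNorm hβ hyz.holder_right ha hc h1.le (by linarith) le_rfl).trans
        (mul_le_mul_of_nonneg_left (Real.rpow_le_rpow (by linarith) (by linarith) hβ.le)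
          (holderNorm_nonneg _ _ _ _))
    have g4 : |x r - x a| ≤ X * (b - a) ^ β :=
      (abs_sub_le_holderNorm hβ hxy.holder_left ha hbT le_rfl h1.le (by linarith)).trans
        (mul_le_mul_of_nonneg_left (Real.rpow_le_rpow j1.le (by linarith) hβ.le) hX)
    have g5 : ‖kernelK α ε r b ξ η‖ ≤
        C₁ * ((b - a) ^ (l + ε) * (ξ - r) ^ (ε - 1) * (η - ξ) ^ (-1 - l)) := by
      refine (H₁ r ξ η b h2 h3 h4).trans ?_
      have k1 : (b - r) ^ l ≤ (b - a) ^ l := Real.rpow_le_rpow j5.le (by linarith) hl0.le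
      have k2 : (b - η) ^ ε ≤ (b - a) ^ ε := Real.rpow_le_rpow j4.le (by linarith) hε₁.le
      calc _ ≤ C₁ * ((b - a) ^ l * (ξ - r) ^ (ε - 1) * (η - ξ) ^ (-1 - l) * (b - a) ^ ε) := by
            gcongr
        _ = _ := by rw [Real.rpow_add hL]; ring
    have g6 : ‖gammaOp (α - ε) xy ξ η * ((z c - z r : ℝ) : ℂ) -
        ((x r - x a : ℝ) : ℂ) * gammaOp (α - ε) yz ξ η‖ ≤ C₂ * Q * (η - ξ) ^ (2 * l) := by
      refine (norm_sub_le _ _).trans ?_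
      rw [norm_mul, norm_mul, Complex.norm_real, Complex.norm_real, Real.norm_eq_abs,
        Real.norm_eq_abs]
      calc _ ≤ (C₂ * A * (η - ξ) ^ (2 * l)) * N +
            (X * (b - a) ^ β) * (C₂ * B * (η - ξ) ^ (2 * l)) := by gcongr
        _ = _ := by rw [hQ]; ring
    have e1 : (r - a) ^ (2 - 2 * α - 1) = ((r - a) ^ (2 * α - 1))⁻¹ := by
      rw [← Real.rpow_neg j1.le]; congr 1; ring
    have e2 : (η - ξ) ^ (l - 1) = (η - ξ) ^ (-1 - l) * (η - ξ) ^ (2 * l) := by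
      rw [← Real.rpow_add j3]; congr 1; ring
    unfold secondIntegrand
    simp only
    rw [norm_mul, norm_div, Complex.norm_real ((r - a) ^ (2 * α - 1)),
      Real.norm_of_nonneg (show 0 ≤ (r - a) ^ (2 * α - 1) by positivity), e1, e2, div_eq_mul_inv]
    calc _ ≤ (C₁ * ((b - a) ^ (l + ε) * (ξ - r) ^ (ε - 1) * (η - ξ) ^ (-1 - l))) *
          ((C₂ * Q * (η - ξ) ^ (2 * l)) * ((r - a) ^ (2 * α - 1))⁻¹) := by gcongr
      _ = _ := by ring

theorem simplex_self (a : ℝ) : simplex a a = ∅ := by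
  ext ⟨r, ξ, η⟩
  simp only [simplex, mem_ofPred_eq, mem_empty_iff_false, iff_false]
  rintro ⟨h1, h2, h3, h4⟩
  linarith

theorem exists_tripleProduct_bound (hβ₂ : β < 1 / 2) (hα₁ : 1 - β < α)
    (hα₂ : α < 2 * β) (hε₁ : 0 < ε) (hε₂ : ε < α + β - 1) : ∃ k : ℝ, 0 < k ∧
      ∀ (x y z : ℝ → ℝ) (xy yz : ℝ → ℝ → ℝ), IsHolderMultiplicative β T x y xy →
        IsHolderMultiplicative β T y z yz →
        ∀ a b c : ℝ, 0 ≤ a → a ≤ b → b ≤ c → c ≤ T →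
          IntervalIntegrable (firstIntegrand α x y z a b c) volume a b ∧
          IntegrableOn (secondIntegrand α ε x z xy yz a b c) (simplex a b) volume ∧
          ‖tripleProduct α ε x y z xy yz a b c‖ ≤
            k * (holderNorm β a b y * holderNorm β a b x * holderNorm β a b z
                  + holderNorm β a b z * holderNorm₂ β a b xy
                  + holderNorm β a b x * holderNorm₂ β a b yz) * (b - a) ^ (3 * β)
              + k * holderNorm β a c z
                * (holderNorm β a b y * holderNorm β a b x + holderNorm₂ β a b xy)
                * (b - a) ^ (2 * β) * (c - a) ^ β := by
  obtain ⟨C₁, hC₁, H₁⟩ := exists_firstIntegrand_bound (T := T) hβ₂ hα₁ hα₂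
  obtain ⟨C₂, hC₂, H₂⟩ := exists_secondIntegrand_bound (T := T) hβ₂ hα₂ hε₁ hε₂
  have hG : 0 ≤ 1 / Real.Gamma (2 - 2 * α) :=
    one_div_nonneg.2 (Real.Gamma_pos_of_pos (by linarith)).le
  set G := 1 / Real.Gamma (2 - 2 * α) with hGdef
  -- The summand `1` only makes the constant strictly positive.
  refine ⟨2 * (C₁ + G * C₂) + 1, by positivity, fun x y z xy yz hxy hyz a b c ha hab hbc hc => ?_⟩
  have hX := holderNorm_nonneg β a b x
  have hY := holderNorm_nonneg β a b y
  have hZ := holderNorm_nonneg β a b z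
  have hZ' := holderNorm_nonneg β a c z
  have hW := holderNorm₂_nonneg β a b xy
  have hV := holderNorm₂_nonneg β a b yz
  have hca : 0 ≤ (c - a) ^ β := Real.rpow_nonneg (by linarith) _
  rcases hab.eq_or_lt with rfl | hab
  -- For `a = b` both domains are null or empty and the product vanishes; the estimates above
  -- require `a < b`.
  · refine ⟨IntervalIntegrable.refl, by simp [simplex_self], ?_⟩
    have : tripleProduct α ε x y z xy yz a a c = 0 := by simp [tripleProduct, simplex_self]
    rw [this, norm_zero, sub_self]
    positivity
  obtain ⟨i1, n1⟩ := H₁ x y z xy yz hxy hyz a b c ha hab hbc hc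
  obtain ⟨i2, n2⟩ := H₂ x y z xy yz hxy hyz a b c ha hab hbc hc
  refine ⟨i1, i2, ?_⟩
  have hL : 0 < b - a := sub_pos.2 hab
  have e3 : (b - a) ^ (3 * β) = (b - a) ^ β * (b - a) ^ (2 * β) := by
    rw [← Real.rpow_add hL]; congr 1; ring
  rw [e3]
  have hD : 0 ≤ (b - a) ^ β := by positivity
  have hD2 : 0 ≤ (b - a) ^ (2 * β) := by positivity
  unfold tripleProduct
  generalize holderNorm β a b x = X at *
  generalize holderNorm β a b y = Y at *
  generalize holderNorm β a b z = Z at *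
  generalize holderNorm β a c z = Z' at *
  generalize holderNorm₂ β a b xy = W at *
  generalize holderNorm₂ β a b yz = V at *
  generalize (b - a) ^ β = D at *
  generalize (b - a) ^ (2 * β) = D2 at *
  generalize (c - a) ^ β = E at *
  have hS : ∀ S₁ S₂ R : ℝ, 0 ≤ R → S₁ ≤ 2 * R → S₂ ≤ 2 * R →
      C₁ * S₁ + G * (C₂ * S₂) ≤ (2 * (C₁ + G * C₂) + 1) * R := by
    intro S₁ S₂ R hR h1 h2
    have hGC : 0 ≤ G * C₂ := by positivity
    have t1 := mul_le_mul_of_nonneg_left h1 hC₁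
    have t2 := mul_le_mul_of_nonneg_left h2 hGC
    linarith
  have p1 : 0 ≤ Y * X * Z * D * D2 := by positivity
  have p2 : 0 ≤ Z * W * D * D2 := by positivity
  have p3 : 0 ≤ X * V * D * D2 := by positivity
  have p4 : 0 ≤ Z' * (Y * X) * D2 * E := by positivity
  have p5 : 0 ≤ Z' * W * D2 * E := by positivity
  calc _ ≤ C₁ * (X * Y * (Z' * E + Z * D)) * D2 +
        G * (C₂ * ((W + X * Y) * (Z' * E) + X * D * (V + Y * Z)) * D2) := by
        refine (norm_add_le _ _).trans (add_le_add n1 ?_)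
        rw [norm_mul, Complex.norm_real, Real.norm_of_nonneg hG]
        exact mul_le_mul_of_nonneg_left n2 hG
    _ = C₁ * (X * Y * (Z' * E + Z * D) * D2) +
        G * (C₂ * (((W + X * Y) * (Z' * E) + X * D * (V + Y * Z)) * D2)) := by ring
    _ ≤ (2 * (C₁ + G * C₂) + 1) * ((Y * X * Z + Z * W + X * V) * (D * D2) +
        Z' * (Y * X + W) * D2 * E) := by
        apply hS <;> linarith
    _ = _ := by ring

end Estimates

end HolderRough

/-! ### The proposition -/

theorem propositionp3p8 (β α ε T : ℝ) (hβ₁ : 1 / 3 < β) (hβ₂ : β < 1 / 2)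
    (hα₁ : 1 - β < α) (hα₂ : α < 2 * β) (hε₁ : 0 < ε) (hε₂ : ε < α + β - 1) (hT : 0 < T) :
    ∃ k : ℝ, 0 < k ∧
      ∀ (x y z : ℝ → ℝ) (xy yz : ℝ → ℝ → ℝ),
        HolderRough.IsHolderMultiplicative β T x y xy →
        HolderRough.IsHolderMultiplicative β T y z yz →
        (∀ a b c : ℝ, 0 ≤ a → a ≤ b → b ≤ c → c ≤ T →
          IntervalIntegrable (HolderRough.firstIntegrand α x y z a b c)
            MeasureTheory.volume a b ∧
          MeasureTheory.IntegrableOn (HolderRough.secondIntegrand α ε x z xy yz a b c)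
            (HolderRough.simplex a b) MeasureTheory.volume ∧
          ‖HolderRough.tripleProduct α ε x y z xy yz a b c‖ ≤
            k * (HolderRough.holderNorm β a b y * HolderRough.holderNorm β a b x
                    * HolderRough.holderNorm β a b z
                  + HolderRough.holderNorm β a b z * HolderRough.holderNorm₂ β a b xy
                  + HolderRough.holderNorm β a b x * HolderRough.holderNorm₂ β a b yz)
                * (b - a) ^ (3 * β)
              + k * HolderRough.holderNorm β a c z
                * (HolderRough.holderNorm β a b y * HolderRough.holderNorm β a b x
                    + HolderRough.holderNorm₂ β a b xy)
                * (b - a) ^ (2 * β) * (c - a) ^ β) ∧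
        (∀ a b : ℝ, 0 ≤ a → a ≤ b → b ≤ T →
          BddAbove (HolderRough.tripleQuotients β α ε x y z xy yz a b) ∧
          HolderRough.holderNorm₃ β α ε x y z xy yz a b ≤
            k * (HolderRough.holderNorm β a b y * HolderRough.holderNorm β a b x
                    * HolderRough.holderNorm β a b z
                  + HolderRough.holderNorm β a b z * HolderRough.holderNorm₂ β a b xy
                  + HolderRough.holderNorm β a b x * HolderRough.holderNorm₂ β a b yz)) := by
  have hβ : 0 < β := by linarith
  obtain ⟨k, hk, H⟩ := HolderRough.exists_tripleProduct_bound (T := T) hβ₂ hα₁ hα₂ hε₁ hε₂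
  -- For `b = c` the second line of the bound repeats two summands of the first, so the norm
  -- estimate takes twice the constant; the first estimate survives the enlargement since all terms
  -- are nonnegative.
  refine ⟨2 * k, by positivity, fun x y z xy yz hxy hyz => ⟨fun a b c ha hab hbc hc => ?_,
    fun a b ha hab hb => ?_⟩⟩
  · obtain ⟨i1, i2, n⟩ := H x y z xy yz hxy hyz a b c ha hab hbc hc
    refine ⟨i1, i2, n.trans ?_⟩
    have hX := HolderRough.holderNorm_nonneg β a b x
    have hY := HolderRough.holderNorm_nonneg β a b y
    have hZ := HolderRough.holderNorm_nonneg β a b z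
    have hZ' := HolderRough.holderNorm_nonneg β a c z
    have hW := HolderRough.holderNorm₂_nonneg β a b xy
    have hV := HolderRough.holderNorm₂_nonneg β a b yz
    have hba : 0 ≤ b - a := sub_nonneg.2 hab
    have hca : 0 ≤ c - a := by linarith
    gcongr <;> linarith
  · have hX := HolderRough.holderNorm_nonneg β a b x
    have hY := HolderRough.holderNorm_nonneg β a b y
    have hZ := HolderRough.holderNorm_nonneg β a b z
    have hW := HolderRough.holderNorm₂_nonneg β a b xy
    have hV := HolderRough.holderNorm₂_nonneg β a b yz
    have key : ∀ v ∈ HolderRough.tripleQuotients β α ε x y z xy yz a b,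
        v ≤ 2 * k * (HolderRough.holderNorm β a b y * HolderRough.holderNorm β a b x
                    * HolderRough.holderNorm β a b z
                  + HolderRough.holderNorm β a b z * HolderRough.holderNorm₂ β a b xy
                  + HolderRough.holderNorm β a b x * HolderRough.holderNorm₂ β a b yz) := by
      rintro v ⟨θ, r, h1, h2, h3, rfl⟩
      have hL : 0 < r - θ := sub_pos.2 h2
      have n := (H x y z xy yz hxy hyz θ r r (by linarith) h2.le le_rfl (by linarith)).2.2
      have e : (r - θ) ^ (3 * β) = (r - θ) ^ (2 * β) * (r - θ) ^ β := by
        rw [← Real.rpow_add hL]; congr 1; ring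
      -- The pointwise bound involves norms over `[θ,r]`; monotonicity in the interval makes it
      -- uniform over `a ≤ θ < r ≤ b`, which gives both finiteness and the bound of the supremum.
      have mX := HolderRough.holderNorm_mono hβ hxy.holder_left ha hb h1 h3
      have mY := HolderRough.holderNorm_mono hβ hxy.holder_right ha hb h1 h3
      have mZ := HolderRough.holderNorm_mono hβ hyz.holder_right ha hb h1 h3
      have mW := HolderRough.holderNorm₂_mono hxy.bound ha hb h1 h3
      have mV := HolderRough.holderNorm₂_mono hyz.bound ha hb h1 h3
      have nX := HolderRough.holderNorm_nonneg β θ r x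
      have nY := HolderRough.holderNorm_nonneg β θ r y
      have nZ := HolderRough.holderNorm_nonneg β θ r z
      have nW := HolderRough.holderNorm₂_nonneg β θ r xy
      have nV := HolderRough.holderNorm₂_nonneg β θ r yz
      rw [div_le_iff₀ (by positivity)]
      refine n.trans ?_
      calc _ = k * (2 * (HolderRough.holderNorm β θ r y * HolderRough.holderNorm β θ r x
                    * HolderRough.holderNorm β θ r z
                  + HolderRough.holderNorm β θ r z * HolderRough.holderNorm₂ β θ r xy)
                  + HolderRough.holderNorm β θ r x * HolderRough.holderNorm₂ β θ r yz)
                    * (r - θ) ^ (3 * β) := by rw [e]; ring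
        _ ≤ k * (2 * (HolderRough.holderNorm β θ r y * HolderRough.holderNorm β θ r x
                    * HolderRough.holderNorm β θ r z
                  + HolderRough.holderNorm β θ r z * HolderRough.holderNorm₂ β θ r xy)
                  + 2 * (HolderRough.holderNorm β θ r x * HolderRough.holderNorm₂ β θ r yz))
                    * (r - θ) ^ (3 * β) := by
            have p := mul_nonneg nX nV
            exact mul_le_mul_of_nonneg_right
              (mul_le_mul_of_nonneg_left (by linarith) hk.le) (by positivity)
        _ ≤ k * (2 * (HolderRough.holderNorm β a b y * HolderRough.holderNorm β a b x
                    * HolderRough.holderNorm β a b z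
                  + HolderRough.holderNorm β a b z * HolderRough.holderNorm₂ β a b xy)
                  + 2 * (HolderRough.holderNorm β a b x * HolderRough.holderNorm₂ β a b yz))
                    * (r - θ) ^ (3 * β) := by gcongr
        _ = _ := by ring
    exact ⟨⟨_, key⟩, Real.sSup_le key (by positivity)⟩
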